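/- **Theorem 5 (arbitrary pulse shape, non-zero noise floor).** Let $s\ge 0$ be a $C^2$ pulse on $\mathbb R$ with $\int s=1$, let $\phi\ge 0$ be a spatial kernel with $\int\phi=1$, and let $\tau:\mathbb R\to\mathbb R$ be a continuous time-of-arrival function. Let $N\ge 1$ be the number of pixels of $[0,1]$. Put $x_n=\frac{2n+1}{2N}$ for $n=0,\dots,N-1$, let $\tau$ be differentiable at each $x_n$, and put $\tau_n=\tau(x_n)$, $c_n=\tau'(x_n)$ and $c^2=\frac1N\sum_n c_n^2$. Let $\alpha_0>0$ be the total flux of the scene, so that each pixel has signal level $\alpha=\alpha_0/N$, and let the noise floor of each pixel be $\lambda_b=\beta\alpha$ with a fixed background-to-signal ratio $\beta>0$. The effective return pulse of pixel $n$ is $\widetilde\lambda_n(t)=(\phi\circledast\lambda(\cdot,t))(x_n)$, where $\lambda(x,t)=\alpha s(t-\tau(x))+\lambda_b$. The effective pulse shape is $s_n(u)=(\phi\circledast s(u+\tau_n-\tau(\cdot)))(x_n)$. Pixel $n$ records the points $t_1,\dots,t_M$ of a Poisson process on $[-T,T]$ with intensity $\widetilde\lambda_n$. All delays are estimated in an interval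 $[a,b]$ with $a<\tau_n<b$ for all $n$. Assume that each effective pulse is normalized on the window, that is, $\int_{-T}^T s_n(t-\theta)\,dt=1$ for $\theta=0$ and for all $\theta\in[a,b]$. Let $\widehat\tau_n$ be a maximum-likelihood estimate, i.e. a measurable choice of a maximizer over $\theta\in[a,b]$ of $\sum_{j=1}^M\log(\alpha s_n(t_j-\theta)+\lambda_b)$. Let $\widehat\tau(x)$ be the function equal to $\widehat\tau_n$ on pixel $n$, let $\tau^{\rm lin}(x)=\tau_n+c_n(x-x_n)$ on pixel $n$, and let $\mathrm{MSE}(\widehat\tau,f)=\mathbb E\int_0^1(\widehat\tau(x)-f(x))^2dx$. No independence between pixels is assumed. Then the following hold. 1. $\widetilde\lambda_n(t)=\alpha s_n(t-\tau_n)+\lambda_b$. 2. The Fisher-information integrals $\int_{-T}^T\frac{(\alpha\dot s_n(t))^2}{\alpha s_n(t)+\lambda_b}\,dt$ are positive, and, to leading order as $\alpha_0\to\infty$ (the ratio of the two sides tends to $1$), the per-pixel variance is $$\mathbb E[(\widehat\tau_n-\tau_n)^2]\sim\left[\int_{-T}^T\frac{(\alpha\dot s_n(t))^2}{\alpha s_n(t)+\lambda_b}\,dt\right]^{-1}.$$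 3. For every $\alpha_0>0$, exactly, $\displaystyle \mathrm{MSE}(\widehat\tau,\tau^{\rm lin})=\frac{c^2}{12N^2}+\frac1N\sum_{n=0}^{N-1}\mathbb E[(\widehat\tau_n-\tau_n)^2].$ 4. Let $V_n=\left[\int_{-T}^T\frac{\dot s_n(t)^2}{s_n(t)+\beta}\,dt\right]^{-1}$ be the per-pixel variance normalized to unit signal level. Then, as $\alpha_0\to\infty$, $$\mathrm{MSE}(\widehat\tau,\tau^{\rm lin})-\frac{c^2}{12N^2}\sim\frac{N}{\alpha_0}\cdot\frac1N\sum_{n=0}^{N-1}V_n ,$$ so that, if all $V_n$ have the same value $V$, the MSE is $\frac{c^2}{12N^2}+\frac{N}{\alpha_0}V$ to leading order. 5. If $\tau$ is differentiable on $[0,1]$ and $\tau'$ is $K$-Lipschitz there, then for every $\alpha_0>0$ $\left|\sqrt{\mathrm{MSE}(\widehat\tau,\tau)}-\sqrt{\mathrm{MSE}(\widehat\tau,\tau^{\rm lin})}\right|\le\frac{K}{8N^2}$. -/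

import Mathlib

open MeasureTheory ProbabilityTheory Filter Topology Set Asymptotics
open scoped BigOperators

noncomputable section

/-- A finite list of time stamps: a number `m` of photons and their arrival times. -/
abbrev TimeStamps : Type := Σ m : ℕ, (Fin m → ℝ)

/-- The law of the (inhomogeneous) Poisson process on `ℝ` with finite intensity measure `μ`: with
`Q = μ ℝ`, the number `M` of points is Poisson of mean `Q`, and given `M = m` the points are i.i.d.
with distribution `μ / Q`. Sorting the points, this is the law with density `e ^ (-Q) ∏ λ (t_j)` on
`t_1 < ... < t_m`, for `μ` of density `λ`. -/
def poissonProcessLaw (μ : Measure ℝ) : Measure TimeStamps :=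
  Measure.sum fun m : ℕ =>
    ENNReal.ofReal (Real.exp (-(μ.real univ)) / (m.factorial : ℝ)) •
      (Measure.pi fun _ : Fin m => μ).map (fun v => (⟨m, v⟩ : TimeStamps))

/-- The law of the time stamps recorded on the window `[-T, T]` under the intensity `lam`. -/
def timeStampLaw (T : ℝ) (lam : ℝ → ℝ) : Measure TimeStamps :=
  poissonProcessLaw
    ((volume.restrict (Icc (-T) T)).withDensity fun t => ENNReal.ofReal (lam t))

/-- The space-time return pulse `α s(t - τ(x)) + λ_b`. -/
def returnPulse (α lamb : ℝ) (s τ : ℝ → ℝ) (x t : ℝ) : ℝ := α * s (t - τ x) + lamb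

/-- Convolution in the space variable of a space-time function with the spatial kernel `φ`. -/
def spatialConv (φ : ℝ → ℝ) (lam : ℝ → ℝ → ℝ) (x t : ℝ) : ℝ :=
  convolution φ (fun x' => lam x' t) (ContinuousLinearMap.mul ℝ ℝ) volume x

/-- The midpoint `(2n+1)/(2N)` of the `n`-th of the `N` pixels of `[0, 1]`. -/
def pixelMid (N : ℕ) (n : Fin N) : ℝ := (2 * (n : ℝ) + 1) / (2 * (N : ℝ))

/-- The effective return pulse at pixel `n`, with signal level `α` and noise floor `λ_b`: the
spatially convolved return pulse at the midpoint of the pixel. -/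
def effIntensity (φ : ℝ → ℝ) (α lamb : ℝ) (s τ : ℝ → ℝ) (N : ℕ) (n : Fin N) (t : ℝ) : ℝ :=
  spatialConv φ (returnPulse α lamb s τ) (pixelMid N n) t

/-- The effective pulse shape `s_n`, centred at delay zero: the shape (`α = 1`, `λ_b = 0`) of the
effective return pulse is `t ↦ s_n (t - τ_n)`, where `τ_n = τ (pixelMid N n)`. -/
def effPulse (φ s τ : ℝ → ℝ) (N : ℕ) (n : Fin N) (u : ℝ) : ℝ :=
  effIntensity φ 1 0 s τ N n (u + τ (pixelMid N n))

/-- The log-likelihood `∑ j, log (α s(t_j - θ) + λ_b)` of the delay `θ`. -/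
def logLik (α lamb : ℝ) (s : ℝ → ℝ) (ts : TimeStamps) (θ : ℝ) : ℝ :=
  ∑ j : Fin ts.1, Real.log (α * s (ts.2 j - θ) + lamb)

/-- `v` is a maximum-likelihood estimate of the delay over the set `Θ`. -/
def IsMLE (α lamb : ℝ) (s : ℝ → ℝ) (Θ : Set ℝ) (ts : TimeStamps) (v : ℝ) : Prop :=
  v ∈ Θ ∧ IsMaxOn (logLik α lamb s ts) Θ v

/-- The Fisher-information integral of the delay. -/
def fisherIntegral (T α lamb : ℝ) (s : ℝ → ℝ) : ℝ :=
  ∫ t in (-T)..T, (α * deriv s t) ^ 2 / (α * s t + lamb)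

/-- The boxcar function. -/
def boxcar (x : ℝ) : ℝ := (Icc (0 : ℝ) 1).indicator (fun _ => 1) x

/-- The piecewise constant function with value `v n` on pixel `n`. -/
def reconstruct (N : ℕ) (v : Fin N → ℝ) (x : ℝ) : ℝ :=
  ∑ n : Fin N, v n * boxcar (N * x - n)

/-- The piecewise linear approximation of `τ`: its tangent at the midpoint, on each pixel. -/
def linearized (N : ℕ) (τ : ℝ → ℝ) (x : ℝ) : ℝ :=
  ∑ n : Fin N,
    (τ (pixelMid N n) + deriv τ (pixelMid N n) * (x - pixelMid N n)) * boxcar (N * x - n)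

/-- The mean squared slope `c² = (1/N) ∑ n, τ'(x_n)²`. -/
def meanSqSlope (N : ℕ) (τ : ℝ → ℝ) : ℝ :=
  (1 / (N : ℝ)) * ∑ n : Fin N, deriv τ (pixelMid N n) ^ 2

/-- `E ∫_0^1 (τ̂(x) - f(x))² dx`, with `τ̂` piecewise constant with values `est n` on pixel `n`. -/
def mse {Ω : Type*} [MeasurableSpace Ω] (P : Measure Ω) (N : ℕ) (est : Fin N → Ω → ℝ)
    (f : ℝ → ℝ) : ℝ :=
  ∫ ω, (∫ x in (0 : ℝ)..1, (reconstruct N (fun n => est n ω) x - f x) ^ 2) ∂P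

/-- The mean squared error `E (τ̂_n - τ_n)²` of one pixel. -/
def pixelError {Ω : Type*} [MeasurableSpace Ω] (P : Measure Ω) (est : Ω → ℝ) (τn : ℝ) : ℝ :=
  ∫ ω, (est ω - τn) ^ 2 ∂P

end

/-! The noise floor is proportional to the signal level `α = α₀ / N`, so the intensity of a pixel is
`α` times a measure that does not depend on the flux. Letting the flux grow is therefore the
large-sample limit of a location model with log-density `L u = log (g u + β)`, where `g` is the
effective pulse.

Sums over a Poisson process have an explicit Laplace functional (`lintegral_exp_pointSum`). It gives
their variance exactly and shows that their fourth central moments are `O(α²)`. The limit concerns a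
second moment, so convergence in law is not enough: since the delay range is bounded, the
exceptional events must have probability `o(1/α)`, and fourth moments provide this. Off these events
the maximizer is close to the truth, because the divergence of a wrong delay is positive
(`integral_log_ratio_neg`) and the range is compact. A Taylor expansion of the score `W` at the
truth then gives `W ≈ -α J h`, with `h` the error and `J` the Fisher information. Hence `J² α h² ≈
W² / α`, which has mean exactly `J`, and `α E h² → 1 / J` (`tendsto_mul_mle_error`).

The normalization on the window supplies the regularity. An average of masses, each at most one, can
equal one only if almost every shifted copy of `s` that enters the average lies in the window. So
`s` has compact support, the effective pulse is `C²` with compact support, distinct delays are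
distinguishable, and the boundary terms of the Fisher identities vanish.

The error against the linearized function is computed pixel by pixel. The cross term between
estimation error and slope integrates to zero by symmetry about the midpoint, so neither
unbiasedness nor independence is needed. The tangent is within `K / (8 N²)` of `τ`, and a Minkowski
inequality carries this over to root mean squared errors. -/

/-! ### Laplace functional and moments of sums over a Poisson process. -/

/-- The sum of `f` over the time stamps. -/
def pointSum (f : ℝ → ℝ) (ts : TimeStamps) : ℝ := ∑ j, f (ts.2 j)

lemma measurable_timeStamps_mk (m : ℕ) :
    Measurable (fun v : Fin m → ℝ => (⟨m, v⟩ : TimeStamps)) := by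
  intro s hs
  exact (MeasurableSpace.measurableSet_iInf.1 hs) m

lemma measurable_pointSum {f : ℝ → ℝ} (hf : Measurable f) : Measurable (pointSum f) := by
  intro s hs
  refine MeasurableSpace.measurableSet_iInf.2 fun m => ?_
  have h : Measurable (fun v : Fin m → ℝ => ∑ j, f (v j)) := by fun_prop
  exact h hs

lemma pointSum_mul_left (c : ℝ) (f : ℝ → ℝ) (ts : TimeStamps) :
    pointSum (fun x => c * f x) ts = c * pointSum f ts := by
  simp [pointSum, Finset.mul_sum]

lemma integrable_of_bounded_measurable {μ : Measure ℝ} [IsFiniteMeasure μ] {f : ℝ → ℝ} {B : ℝ}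
    (hf : Measurable f) (hB : ∀ x, |f x| ≤ B) : Integrable f μ :=
  Integrable.of_bound hf.aestronglyMeasurable B (ae_of_all _ hB)

lemma integrable_exp_of_bounded {μ : Measure ℝ} [IsFiniteMeasure μ] {f : ℝ → ℝ} {B : ℝ}
    (hf : Measurable f) (hB : ∀ x, |f x| ≤ B) : Integrable (fun x => Real.exp (f x)) μ :=
  integrable_of_bounded_measurable (B := Real.exp B) (by fun_prop) fun x => by
    rw [abs_of_pos (Real.exp_pos _)]
    exact Real.exp_le_exp.2 ((le_abs_self _).trans (hB x))

/-- The Laplace functional of the Poisson process. -/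
lemma lintegral_exp_pointSum (μ : Measure ℝ) [IsFiniteMeasure μ] {f : ℝ → ℝ} {B : ℝ}
    (hf : Measurable f) (hB : ∀ x, |f x| ≤ B) :
    ∫⁻ ts, ENNReal.ofReal (Real.exp (pointSum f ts)) ∂poissonProcessLaw μ =
      ENNReal.ofReal (Real.exp ((∫ x, Real.exp (f x) ∂μ) - μ.real univ)) := by
  have hmeas : Measurable fun ts => ENNReal.ofReal (Real.exp (pointSum f ts)) :=
    (Real.measurable_exp.comp (measurable_pointSum hf)).ennreal_ofReal
  have hint : Integrable (fun x => Real.exp (f x)) μ := integrable_exp_of_bounded hf hB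
  set I := ∫ x, Real.exp (f x) ∂μ with hI
  have hI0 : 0 ≤ I := integral_nonneg fun x => (Real.exp_pos _).le
  have hterm : ∀ m : ℕ, ∫⁻ v : Fin m → ℝ, ENNReal.ofReal (Real.exp (pointSum f ⟨m, v⟩))
      ∂(Measure.pi fun _ : Fin m => μ) = ENNReal.ofReal (I ^ m) := by
    intro m
    have h1 : ∀ v : Fin m → ℝ, Real.exp (pointSum f ⟨m, v⟩) = ∏ j, Real.exp (f (v j)) := by
      intro v; simp [pointSum, Real.exp_sum]
    simp_rw [h1]
    rw [← ofReal_integral_eq_lintegral_ofReal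
      (Integrable.fintype_prod (f := fun _ x => Real.exp (f x)) fun _ => hint)
      (ae_of_all _ fun v => Finset.prod_nonneg fun j _ => (Real.exp_pos _).le)]
    rw [integral_fintype_prod_eq_pow (fun x => Real.exp (f x)), Fintype.card_fin]
  rw [poissonProcessLaw, lintegral_sum_measure]
  have h2 : ∀ m : ℕ, ∫⁻ ts, ENNReal.ofReal (Real.exp (pointSum f ts))
      ∂(ENNReal.ofReal (Real.exp (-(μ.real univ)) / (m.factorial : ℝ)) •
        (Measure.pi fun _ : Fin m => μ).map (fun v => (⟨m, v⟩ : TimeStamps))) =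
      ENNReal.ofReal (Real.exp (-(μ.real univ)) * (I ^ m / (m.factorial : ℝ))) := by
    intro m
    rw [lintegral_smul_measure, lintegral_map hmeas (measurable_timeStamps_mk m), hterm,
      smul_eq_mul, ← ENNReal.ofReal_mul (by positivity)]
    congr 1; ring
  simp_rw [h2]
  -- The weights `1 / m!` of the Poisson number of points turn the powers of `I` into the
  -- exponential series.
  have hs : HasSum (fun m : ℕ => I ^ m / (m.factorial : ℝ)) (Real.exp I) := by
    rw [Real.exp_eq_exp_ℝ]; exact NormedSpace.expSeries_div_hasSum_exp I
  have hs' := hs.mul_left (Real.exp (-(μ.real univ)))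
  rw [← ENNReal.ofReal_tsum_of_nonneg (fun m => by positivity) hs'.summable, hs'.tsum_eq,
    ← Real.exp_add, sub_eq_neg_add]

section moments

variable {Ω : Type*} [MeasurableSpace Ω] {P : Measure Ω} {μ : Measure ℝ}
  {X : Ω → TimeStamps} {f : ℝ → ℝ} {B : ℝ}

lemma aemeasurable_pointSum_comp (hX : HasLaw X (poissonProcessLaw μ) P) (hf : Measurable f) :
    AEMeasurable (fun ω => pointSum f (X ω)) P :=
  (measurable_pointSum hf).comp_aemeasurable hX.aemeasurable

variable [IsFiniteMeasure μ]

lemma integrable_exp_pointSum_comp (hX : HasLaw X (poissonProcessLaw μ) P) (hf : Measurable f)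
    (hB : ∀ x, |f x| ≤ B) :
    Integrable (fun ω => Real.exp (pointSum f (X ω))) P ∧
      ∫ ω, Real.exp (pointSum f (X ω)) ∂P =
        Real.exp ((∫ x, Real.exp (f x) ∂μ) - μ.real univ) := by
  have hae : AEMeasurable (fun ω => Real.exp (pointSum f (X ω))) P :=
    Real.measurable_exp.comp_aemeasurable (aemeasurable_pointSum_comp hX hf)
  have hmeas : Measurable fun ts => ENNReal.ofReal (Real.exp (pointSum f ts)) :=
    (Real.measurable_exp.comp (measurable_pointSum hf)).ennreal_ofReal
  have hl : ∫⁻ ω, ENNReal.ofReal (Real.exp (pointSum f (X ω))) ∂P =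
      ENNReal.ofReal (Real.exp ((∫ x, Real.exp (f x) ∂μ) - μ.real univ)) := by
    rw [← lintegral_exp_pointSum μ hf hB, ← hX.lintegral_comp hmeas.aemeasurable]
  refine ⟨⟨hae.aestronglyMeasurable, ?_⟩, ?_⟩
  · rw [hasFiniteIntegral_iff_ofReal (ae_of_all _ fun ω => (Real.exp_pos _).le), hl]
    exact ENNReal.ofReal_lt_top
  · rw [integral_eq_lintegral_of_nonneg_ae (ae_of_all _ fun ω => (Real.exp_pos _).le)
      hae.aestronglyMeasurable, hl, ENNReal.toReal_ofReal (Real.exp_pos _).le]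

/-- The Laplace functional at `t * f`. Its logarithm is `mgf f μ t` minus a constant, so the
cumulants of the sum are the moments of `f` under `μ`. -/
lemma mgf_pointSum_comp (hX : HasLaw X (poissonProcessLaw μ) P) (hf : Measurable f)
    (hB : ∀ x, |f x| ≤ B) (t : ℝ) :
    Integrable (fun ω => Real.exp (t * pointSum f (X ω))) P ∧
      mgf (fun ω => pointSum f (X ω)) P t = Real.exp (mgf f μ t - μ.real univ) := by
  have h := integrable_exp_pointSum_comp hX (f := fun x => t * f x) (B := |t| * B)
    (by fun_prop) (fun x => by rw [abs_mul]; exact mul_le_mul_of_nonneg_left (hB x) (abs_nonneg t))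
  simp_rw [pointSum_mul_left] at h
  exact h

lemma integrableExpSet_pointSum_comp (hX : HasLaw X (poissonProcessLaw μ) P) (hf : Measurable f)
    (hB : ∀ x, |f x| ≤ B) : integrableExpSet (fun ω => pointSum f (X ω)) P = univ :=
  eq_univ_of_forall fun t => (mgf_pointSum_comp hX hf hB t).1

lemma integrableExpSet_of_bounded (hf : Measurable f) (hB : ∀ x, |f x| ≤ B) :
    integrableExpSet f μ = univ :=
  eq_univ_of_forall fun t => integrable_exp_of_bounded (f := fun x => t * f x) (B := |t| * B)
    (by fun_prop) (fun x => by rw [abs_mul]; exact mul_le_mul_of_nonneg_left (hB x) (abs_nonneg t))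

/-- Campbell's formula for the variance. -/
lemma integral_pointSum_sq [IsProbabilityMeasure P] (hX : HasLaw X (poissonProcessLaw μ) P)
    (hf : Measurable f) (hB : ∀ x, |f x| ≤ B) :
    ∫ ω, (pointSum f (X ω) - ∫ x, f x ∂μ) ^ 2 ∂P = ∫ x, f x ^ 2 ∂μ := by
  have h0 : (0 : ℝ) ∈ interior (integrableExpSet (fun ω => pointSum f (X ω)) P) := by
    rw [integrableExpSet_pointSum_comp hX hf hB]; simp
  have h0' : (0 : ℝ) ∈ interior (integrableExpSet f μ) := by
    rw [integrableExpSet_of_bounded hf hB]; simp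
  -- The first two derivatives at zero of the two sides are mean and variance on the left, `∫ f` and
  -- `∫ f²` on the right.
  have hc : cgf (fun ω => pointSum f (X ω)) P = fun t => mgf f μ t - μ.real univ := by
    funext t
    rw [cgf, (mgf_pointSum_comp hX hf hB t).2, Real.log_exp]
  have h1 := deriv_cgf_zero h0
  have h2 := iteratedDeriv_two_cgf_eq_integral h0
  have hd : deriv (fun t => mgf f μ t - μ.real univ) = deriv (mgf f μ) := by
    funext t; simp
  rw [hc, hd, deriv_mgf_zero h0'] at h1
  have h3 : iteratedDeriv 2 (cgf (fun ω => pointSum f (X ω)) P) 0 = ∫ x, f x ^ 2 ∂μ := by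
    have h4 := iteratedDeriv_mgf_zero h0' 2
    simp only [Pi.pow_apply] at h4
    rw [← h4, hc]
    simp only [iteratedDeriv_succ, iteratedDeriv_zero, hd]
  rw [h3, deriv_cgf_zero h0] at h2
  simp only [probReal_univ, div_one, zero_mul, Real.exp_zero, mul_one, mgf_zero] at h1 h2
  rw [h1, h2]

/-- Reduces a fourth moment to exponential moments at two opposite arguments. -/
lemma pow_four_le_exp (x : ℝ) : x ^ 4 ≤ 24 * (Real.exp x + Real.exp (-x)) := by
  have key : ∀ y : ℝ, 0 ≤ y → y ^ 4 ≤ 24 * Real.exp y := fun y hy => by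
    have := Real.pow_div_factorial_le_exp y hy 4
    norm_num [Nat.factorial] at this
    linarith
  rcases le_total 0 x with h | h
  · linarith [key x h, Real.exp_pos (-x)]
  · have := key (-x) (by linarith)
    have e : (-x) ^ 4 = x ^ 4 := by ring
    linarith [Real.exp_pos x]

lemma exp_le_one_add_add_sq {x : ℝ} (hx : |x| ≤ 1) : Real.exp x ≤ 1 + x + x ^ 2 := by
  have := Real.abs_exp_sub_one_sub_id_le hx
  linarith [le_abs_self (Real.exp x - 1 - x)]

/-- The fourth central moment of a sum over a Poisson process with intensity `α • ν` is of
order `α ^ 2`. -/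
lemma pointSum_fourth_moment_le {ν : Measure ℝ} [IsFiniteMeasure ν]
    (hf : Measurable f) (hB1 : 1 ≤ B) (hB : ∀ x, |f x| ≤ B) {α : ℝ} (hα : 1 ≤ α)
    (hX : HasLaw X (poissonProcessLaw (ENNReal.ofReal α • ν)) P) :
    Integrable (fun ω => (pointSum f (X ω) - α * ∫ x, f x ∂ν) ^ 4) P ∧
      ∫ ω, (pointSum f (X ω) - α * ∫ x, f x ∂ν) ^ 4 ∂P ≤
        48 * Real.exp (ν.real univ) * B ^ 4 * α ^ 2 := by
  have hα0 : 0 < α := by linarith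
  have hfin : IsFiniteMeasure (ENNReal.ofReal α • ν) := Measure.smul_finite ν ENNReal.ofReal_ne_top
  set Y := fun ω => pointSum f (X ω) - α * ∫ x, f x ∂ν with hY
  -- At this scale `t * B ≤ 1` and `α * (t * B) ^ 2 = 1`: the quadratic bound on the exponential
  -- applies, and the exponential moments of the centred sum at `±t` are bounded independently of
  -- `α`. Undoing the scaling costs `t⁻⁴ = B⁴ α²`.
  set t := 1 / (B * √α) with ht
  have hsq : 0 < √α := Real.sqrt_pos.2 hα0
  have hsq1 : 1 ≤ √α := Real.one_le_sqrt.2 hα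
  have hB0 : 0 < B := by linarith
  have ht0 : 0 < t := by positivity
  have htB : t * B ≤ 1 := by
    rw [ht, div_mul_eq_mul_div, one_mul, div_le_one (by positivity)]
    nlinarith
  have htα : α * (t * B) ^ 2 = 1 := by
    rw [ht]; field_simp; rw [Real.sq_sqrt hα0.le]
  have key : ∀ r : ℝ, |r| = t → Integrable (fun ω => Real.exp (r * Y ω)) P ∧
      ∫ ω, Real.exp (r * Y ω) ∂P ≤ Real.exp (ν.real univ) := by
    intro r hr
    have hm := mgf_pointSum_comp hX hf hB r
    have he : ∀ ω, Real.exp (r * Y ω) =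
        Real.exp (-(r * (α * ∫ x, f x ∂ν))) * Real.exp (r * pointSum f (X ω)) := by
      intro ω; rw [← Real.exp_add]; congr 1; simp only [hY]; ring
    simp_rw [he]
    refine ⟨hm.1.const_mul _, ?_⟩
    rw [integral_const_mul]
    have : ∫ ω, Real.exp (r * pointSum f (X ω)) ∂P = _ := hm.2
    rw [this, ← Real.exp_add]
    apply Real.exp_le_exp.2
    have hm1 : mgf f (ENNReal.ofReal α • ν) r = α * ∫ x, Real.exp (r * f x) ∂ν := by
      rw [mgf, integral_smul_measure, ENNReal.toReal_ofReal hα0.le, smul_eq_mul]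
    have hu : (ENNReal.ofReal α • ν).real univ = α * ν.real univ := by
      simp [measureReal_def, ENNReal.toReal_ofReal hα0.le]
    rw [hm1, hu]
    have hrf : ∀ x, |r * f x| ≤ t * B := fun x => by
      rw [abs_mul, hr]; exact mul_le_mul_of_nonneg_left (hB x) ht0.le
    have hle : ∫ x, Real.exp (r * f x) ∂ν ≤ ∫ x, ((1 + (t * B) ^ 2) + r * f x) ∂ν := by
      apply integral_mono
      · exact integrable_exp_of_bounded (by fun_prop) hrf
      · exact (integrable_const _).add ((integrable_of_bounded_measurable hf hB).const_mul r)
      · intro x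
        have h1 := exp_le_one_add_add_sq ((hrf x).trans htB)
        have h2 : (r * f x) ^ 2 ≤ (t * B) ^ 2 := by
          rw [← sq_abs (r * f x)]; exact pow_le_pow_left₀ (abs_nonneg _) (hrf x) 2
        simp only
        linarith
    rw [integral_add (integrable_const _) ((integrable_of_bounded_measurable hf hB).const_mul r),
      integral_const, integral_const_mul, smul_eq_mul] at hle
    have h3 := mul_le_mul_of_nonneg_left hle hα0.le
    have h4 : α * (ν.real univ * (1 + (t * B) ^ 2) + r * ∫ x, f x ∂ν) =
        α * ν.real univ + ν.real univ * (α * (t * B) ^ 2) + r * (α * ∫ x, f x ∂ν) := by ring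
    rw [h4, htα] at h3
    linarith
  have k1 := key t (abs_of_pos ht0)
  have k2 := key (-t) (by rw [abs_neg, abs_of_pos ht0])
  have hpt : ∀ ω, Y ω ^ 4 ≤ (24 * B ^ 4 * α ^ 2) *
      (Real.exp (t * Y ω) + Real.exp (-t * Y ω)) := by
    intro ω
    have h1 := pow_four_le_exp (t * Y ω)
    have h2 : Y ω ^ 4 = (B ^ 4 * α ^ 2) * (t * Y ω) ^ 4 := by
      have : B ^ 4 * α ^ 2 * (t * Y ω) ^ 4 = (α * (t * B) ^ 2) ^ 2 * Y ω ^ 4 := by ring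
      rw [this, htα]; ring
    rw [h2, neg_mul]
    have := mul_le_mul_of_nonneg_left h1 (by positivity : 0 ≤ B ^ 4 * α ^ 2)
    linarith
  have hdom := (k1.1.add k2.1).const_mul (24 * B ^ 4 * α ^ 2)
  have hYm : AEStronglyMeasurable (fun ω => Y ω ^ 4) P :=
    (((aemeasurable_pointSum_comp hX hf).sub_const _).pow_const 4).aestronglyMeasurable
  have hint : Integrable (fun ω => Y ω ^ 4) P := by
    refine hdom.mono' hYm (ae_of_all _ fun ω => ?_)
    rw [Real.norm_of_nonneg (by positivity)]
    exact hpt ω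
  refine ⟨hint, ?_⟩
  calc ∫ ω, Y ω ^ 4 ∂P ≤ ∫ ω, (24 * B ^ 4 * α ^ 2) *
        (Real.exp (t * Y ω) + Real.exp (-t * Y ω)) ∂P := integral_mono hint hdom hpt
    _ = (24 * B ^ 4 * α ^ 2) * (∫ ω, Real.exp (t * Y ω) ∂P + ∫ ω, Real.exp (-t * Y ω) ∂P) := by
        rw [integral_const_mul, integral_add k1.1 k2.1]
    _ ≤ (24 * B ^ 4 * α ^ 2) * (Real.exp (ν.real univ) + Real.exp (ν.real univ)) := by
        gcongr
        · exact k1.2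
        · exact k2.2
    _ = _ := by ring

end moments

/-! ### Events of probability `o(1 / r)`. -/

/-- Events whose probability is of smaller order than the inverse of the rate `r`. -/
def RateNegligible {ι Ω : Type*} [MeasurableSpace Ω] (P : Measure Ω) (l : Filter ι) (r : ι → ℝ)
    (A : ι → Set Ω) : Prop :=
  Tendsto (fun i => r i * P.real (A i)) l (𝓝 0)

section negligible

variable {ι Ω : Type*} [MeasurableSpace Ω] {P : Measure Ω}
  {l : Filter ι} {r : ι → ℝ}

lemma RateNegligible.union {A B : ι → Set Ω} (hr : Tendsto r l atTop)
    (hA : RateNegligible P l r A) (hB : RateNegligible P l r B) :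
    RateNegligible P l r (fun i => A i ∪ B i) := by
  have hAB := hA.add hB
  rw [add_zero] at hAB
  refine tendsto_of_tendsto_of_tendsto_of_le_of_le' tendsto_const_nhds hAB ?_ ?_
  · filter_upwards [hr.eventually_gt_atTop 0] with i hi
    positivity
  · filter_upwards [hr.eventually_gt_atTop 0] with i hi
    rw [← mul_add]
    exact mul_le_mul_of_nonneg_left (measureReal_union_le _ _) hi.le

variable [IsProbabilityMeasure P]

lemma RateNegligible.mono {A B : ι → Set Ω} (hr : Tendsto r l atTop)
    (hB : RateNegligible P l r B) (h : ∀ i, 0 < r i → A i ⊆ B i) : RateNegligible P l r A := by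
  refine tendsto_of_tendsto_of_tendsto_of_le_of_le' tendsto_const_nhds hB ?_ ?_
  · filter_upwards [hr.eventually_gt_atTop 0] with i hi
    positivity
  · filter_upwards [hr.eventually_gt_atTop 0] with i hi
    exact mul_le_mul_of_nonneg_left (measureReal_mono (h i hi)) hi.le

end negligible

/-! ### Deviations, consistency and the expansion of the score. -/

section estimation

variable {ι Ω : Type*} [MeasurableSpace Ω] {P : Measure Ω} [IsProbabilityMeasure P]
  {l : Filter ι} {r : ι → ℝ} {ν : Measure ℝ} [IsFiniteMeasure ν] {X : ι → Ω → TimeStamps}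

lemma pointSum_sub (f g : ℝ → ℝ) (ts : TimeStamps) :
    pointSum (fun x => f x - g x) ts = pointSum f ts - pointSum g ts := by
  simp [pointSum]

/-- Uniform closeness of the summands is paid once per photon; the photon count, the sum of the
constant `1`, is controlled by a deviation estimate of its own. -/
lemma abs_pointSum_sub_le {f g : ℝ → ℝ} {c : ℝ} (h : ∀ x, |f x - g x| ≤ c) (ts : TimeStamps) :
    |pointSum f ts - pointSum g ts| ≤ c * pointSum (fun _ => 1) ts := by
  rw [← pointSum_sub, ← pointSum_mul_left]
  exact (Finset.abs_sum_le_sum_abs _ _).trans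
    (Finset.sum_le_sum fun j _ => (h _).trans_eq (mul_one c).symm)

/-- Markov's inequality for the fourth power gives probability `O(r⁻²)`. Chebyshev's inequality
would give only `O(r⁻¹)`, which is not negligible at rate `r`. -/
lemma rateNegligible_pointSum_deviation (hr : Tendsto r l atTop)
    (hX : ∀ᶠ i in l, HasLaw (X i) (poissonProcessLaw (ENNReal.ofReal (r i) • ν)) P)
    {f : ℝ → ℝ} {B : ℝ} (hf : Measurable f) (hB : ∀ x, |f x| ≤ B) {ε : ℝ} (hε : 0 < ε) :
    RateNegligible P l r
      (fun i => {ω | ε * r i ≤ |pointSum f (X i ω) - r i * ∫ x, f x ∂ν|}) := by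
  set C := 48 * Real.exp (ν.real univ) * (max B 1) ^ 4
  have hlim : Tendsto (fun i => C / ε ^ 4 * (r i)⁻¹) l (𝓝 0) := by
    simpa using (tendsto_inv_atTop_zero.comp hr).const_mul (C / ε ^ 4)
  refine tendsto_of_tendsto_of_tendsto_of_le_of_le' tendsto_const_nhds hlim ?_ ?_
  · filter_upwards [hr.eventually_gt_atTop 0] with i hi
    positivity
  · filter_upwards [hr.eventually_ge_atTop 1, hX] with i hi hXi
    have hi0 : 0 < r i := by linarith
    obtain ⟨h1, h2⟩ := pointSum_fourth_moment_le hf (le_max_right B 1)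
      (fun x => (hB x).trans (le_max_left B 1)) hi hXi
    have h0 : ∀ ω, 0 ≤ (pointSum f (X i ω) - r i * ∫ x, f x ∂ν) ^ 4 := fun ω => by positivity
    have h3 := mul_meas_ge_le_integral_of_nonneg (ae_of_all P h0) h1 ((ε * r i) ^ 4)
    have hsub : {ω | ε * r i ≤ |pointSum f (X i ω) - r i * ∫ x, f x ∂ν|} ⊆
        {ω | (ε * r i) ^ 4 ≤ (pointSum f (X i ω) - r i * ∫ x, f x ∂ν) ^ 4} := by
      intro ω hω
      have hω' : ε * r i ≤ |pointSum f (X i ω) - r i * ∫ x, f x ∂ν| := hω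
      have := pow_le_pow_left₀ (by positivity) hω' 4
      rwa [Even.pow_abs (by decide)] at this
    have h4 := (mul_le_mul_of_nonneg_left (measureReal_mono (μ := P) hsub)
      (by positivity : 0 ≤ (ε * r i) ^ 4)).trans (h3.trans h2)
    rw [← div_eq_mul_inv, le_div_iff₀ hi0, le_div_iff₀ (by positivity)]
    refine le_of_mul_le_mul_right ?_ (by positivity : 0 < (r i) ^ 2)
    calc _ = (ε * r i) ^ 4 * P.real {ω | ε * r i ≤ |pointSum f (X i ω) - r i * ∫ x, f x ∂ν|} := by
            ring
      _ ≤ _ := h4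

/-- Near a parameter with positive divergence from the truth, no parameter beats the truth. -/
lemma exists_nhds_rateNegligible (hr : Tendsto r l atTop)
    (hX : ∀ᶠ i in l, HasLaw (X i) (poissonProcessLaw (ENNReal.ofReal (r i) • ν)) P)
    {L : ℝ → ℝ → ℝ} (hL : ∀ θ, Measurable (L θ)) {B : ℝ} (hB : ∀ θ x, |L θ x| ≤ B)
    {K : ℝ} (hK0 : 0 ≤ K) (hK : ∀ θ θ' x, |L θ x - L θ' x| ≤ K * |θ - θ'|) {θ₀ θ₁ : ℝ}
    (hneg : ∫ x, (L θ₁ x - L θ₀ x) ∂ν < 0) :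
    ∃ U ∈ 𝓝 θ₁, RateNegligible P l r
      (fun i => {ω | ∃ θ ∈ U, pointSum (L θ₀) (X i ω) ≤ pointSum (L θ) (X i ω)}) := by
  set κ := -∫ x, (L θ₁ x - L θ₀ x) ∂ν with hκ
  set Q := ν.real univ with hQ
  have hκ0 : 0 < κ := by linarith
  have hQ0 : 0 ≤ Q := measureReal_nonneg
  -- With at most `r * (Q + 1)` photons, moving the parameter by `ρ` changes the log-likelihood by
  -- at most `r * κ / 4`. The drift at `θ₁` is `-r * κ`, and fluctuations take at most half of it.
  -- The added ones keep the denominator positive.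
  set ρ := κ / (4 * (K + 1) * (Q + 1)) with hρ
  have hρ0 : 0 < ρ := by positivity
  have hρK : K * ρ * (Q + 1) ≤ κ / 4 := by
    have h1 : (K + 1) * ρ * (Q + 1) = κ / 4 := by rw [hρ]; field_simp
    have h2 : K * ρ * (Q + 1) ≤ (K + 1) * ρ * (Q + 1) := by gcongr; linarith
    linarith
  refine ⟨Metric.ball θ₁ ρ, Metric.ball_mem_nhds _ hρ0, ?_⟩
  have n1 := rateNegligible_pointSum_deviation hr hX (f := fun x => L θ₁ x - L θ₀ x) (B := B + B)
    ((hL θ₁).sub (hL θ₀)) (fun x => (abs_sub _ _).trans (add_le_add (hB _ x) (hB _ x)))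
    (half_pos hκ0)
  have n2 := rateNegligible_pointSum_deviation hr hX (f := fun _ => 1) (B := 1)
    measurable_const (fun x => by simp) one_pos
  refine (n1.union hr n2).mono hr ?_
  rintro i hi ω ⟨θ, hθ, hle⟩
  by_contra hcon
  simp only [mem_union, mem_ofPred_eq, not_or, not_le, integral_const, smul_eq_mul, mul_one,
    one_mul] at hcon
  obtain ⟨c1, c2⟩ := hcon
  rw [pointSum_sub, abs_lt] at c1
  rw [abs_lt] at c2
  have h1 := abs_pointSum_sub_le (hK θ θ₁) (X i ω)
  have h2 : K * |θ - θ₁| * pointSum (fun _ => 1) (X i ω) ≤ K * ρ * (r i * (Q + 1)) := by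
    have hd : |θ - θ₁| ≤ ρ := by
      rw [Metric.mem_ball, Real.dist_eq] at hθ; exact hθ.le
    have hM : 0 ≤ pointSum (fun _ => 1) (X i ω) := by simp [pointSum]
    gcongr
    linarith [c2.2]
  have h3 : K * ρ * (r i * (Q + 1)) ≤ r i * (κ / 4) := by
    have := mul_le_mul_of_nonneg_left hρK hi.le
    linarith
  have h4 := (abs_le.1 h1).2
  have h5 : r i * ∫ x, (L θ₁ x - L θ₀ x) ∂ν = - (r i * κ) := by rw [hκ]; ring
  rw [h5] at c1
  have h6 : 0 < r i * κ := by positivity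
  nlinarith [c1.2]

/-- Consistency, with a rate: away from the truth, no parameter of a compact set beats it. -/
lemma rateNegligible_of_isCompact (hr : Tendsto r l atTop)
    (hX : ∀ᶠ i in l, HasLaw (X i) (poissonProcessLaw (ENNReal.ofReal (r i) • ν)) P)
    {L : ℝ → ℝ → ℝ} (hL : ∀ θ, Measurable (L θ)) {B : ℝ} (hB : ∀ θ x, |L θ x| ≤ B)
    {K : ℝ} (hK0 : 0 ≤ K) (hK : ∀ θ θ' x, |L θ x - L θ' x| ≤ K * |θ - θ'|) {θ₀ : ℝ}
    {S : Set ℝ} (hS : IsCompact S) (hneg : ∀ θ ∈ S, ∫ x, (L θ x - L θ₀ x) ∂ν < 0) :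
    RateNegligible P l r
      (fun i => {ω | ∃ θ ∈ S, pointSum (L θ₀) (X i ω) ≤ pointSum (L θ) (X i ω)}) := by
  -- The property passes to subsets and finite unions, so compactness reduces it to neighbourhoods
  -- of single parameters.
  refine hS.induction_on (p := fun S => RateNegligible P l r
      (fun i => {ω | ∃ θ ∈ S, pointSum (L θ₀) (X i ω) ≤ pointSum (L θ) (X i ω)})) ?_ ?_ ?_ ?_
  · simp [RateNegligible, tendsto_const_nhds]
  · intro s t hst ht
    exact ht.mono hr fun i _ ω ⟨θ, hθ, h⟩ => ⟨θ, hst hθ, h⟩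
  · intro s t hs ht
    refine (hs.union hr ht).mono hr ?_
    rintro i _ ω ⟨θ, hθ | hθ, h⟩
    · exact Or.inl ⟨θ, hθ, h⟩
    · exact Or.inr ⟨θ, hθ, h⟩
  · intro θ hθ
    obtain ⟨U, hU, h⟩ := exists_nhds_rateNegligible hr hX hL hB hK0 hK (hneg θ hθ)
    exact ⟨U, mem_nhdsWithin_of_mem_nhds hU, h⟩

/-- The Taylor expansion of the score at an interior maximizer of a location log-likelihood. -/
lemma exists_score_eq_mul {L p q : ℝ → ℝ} (hL : ∀ u, HasDerivAt L (p u) u)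
    (hp : ∀ u, HasDerivAt p (q u) u) {a b θ₀ v : ℝ} (hv : v ∈ Ioo a b) (ts : TimeStamps)
    (hmax : IsMaxOn (fun θ => pointSum (fun t => L (t - θ)) ts) (Icc a b) v) :
    ∃ ξ, |ξ - θ₀| ≤ |v - θ₀| ∧
      pointSum (fun t => p (t - θ₀)) ts = pointSum (fun t => q (t - ξ)) ts * (v - θ₀) := by
  have hd : ∀ {f f' : ℝ → ℝ}, (∀ u, HasDerivAt f (f' u) u) → ∀ θ,
      HasDerivAt (fun θ => pointSum (fun t => f (t - θ)) ts)
        (-pointSum (fun t => f' (t - θ)) ts) θ := by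
    intro f f' hf θ
    simp only [pointSum, ← Finset.sum_neg_distrib]
    refine HasDerivAt.fun_sum fun j _ => ?_
    have := (hf (ts.2 j - θ)).comp θ ((hasDerivAt_id θ).const_sub (ts.2 j))
    simpa [Function.comp_def] using this
  have hcrit : pointSum (fun t => p (t - v)) ts = 0 := by
    have hloc := hmax.isLocalMax (Icc_mem_nhds hv.1 hv.2)
    have := hloc.hasDerivAt_eq_zero (hd hL v)
    linarith
  -- The score along the segment from `θ₀` to `v`, run over `[0, 1]` so that the mean value theorem
  -- needs no case distinction on the order of `θ₀` and `v`.
  set k := fun x : ℝ => pointSum (fun t => p (t - (θ₀ + x * (v - θ₀)))) ts with hk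
  have hk' : ∀ x, HasDerivAt k
      (-pointSum (fun t => q (t - (θ₀ + x * (v - θ₀)))) ts * (v - θ₀)) x := by
    intro x
    have h1 : HasDerivAt (fun x : ℝ => θ₀ + x * (v - θ₀)) (v - θ₀) x := by
      simpa using ((hasDerivAt_id x).mul_const (v - θ₀)).const_add θ₀
    exact (hd hp (θ₀ + x * (v - θ₀))).comp x h1
  obtain ⟨x, hx, hslope⟩ := exists_hasDerivAt_eq_slope k _ zero_lt_one
    (fun x _ => (hk' x).continuousAt.continuousWithinAt) (fun x _ => hk' x)
  refine ⟨θ₀ + x * (v - θ₀), ?_, ?_⟩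
  · rw [add_sub_cancel_left, abs_mul, abs_of_pos hx.1]
    exact mul_le_of_le_one_left (abs_nonneg _) hx.2.le
  · have k0 : k 0 = pointSum (fun t => p (t - θ₀)) ts := by simp [hk]
    have k1 : k 1 = 0 := by simp only [hk, one_mul, add_sub_cancel]; exact hcrit
    rw [k0, k1] at hslope
    linarith

/-- The comparison of the scaled squared error `J² r h²` with the scaled squared score `W² / r`. -/
lemma abs_error_sub_score_le {J r W c h ε : ℝ} (hJ : 0 < J) (hr : 0 < r) (hε : 0 < ε)
    (hε1 : ε ≤ 1 / 2) (hW : W = c * h) (hc : |c + r * J| ≤ ε * J * r) :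
    |J ^ 2 * (r * h ^ 2) - W ^ 2 / r| ≤ 12 * ε * (W ^ 2 / r) := by
  -- The relative error of the observed curvature `c` against `-r * J`. The scaled squared score is
  -- then the scaled squared error times `(1 + e) ^ 2`, and this factor is at least `1 / 4` because
  -- `ε ≤ 1 / 2`.
  set e := -c / (r * J) - 1 with he
  have hce : c = -(r * J * (1 + e)) := by rw [he]; field_simp; ring
  have hee : |e| ≤ ε := by
    have h1 : c + r * J = -(r * J) * e := by rw [hce]; ring
    rw [h1, abs_mul, abs_neg, abs_of_pos (by positivity)] at hc
    have h2 : r * J * |e| ≤ r * J * ε := by linarith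
    exact le_of_mul_le_mul_left h2 (by positivity)
  obtain ⟨e1, e2⟩ := abs_le.1 hee
  have hY : W ^ 2 / r = J ^ 2 * (r * h ^ 2) * (1 + e) ^ 2 := by
    rw [hW, hce]; field_simp
  rw [hY]
  set H := J ^ 2 * (r * h ^ 2)
  have hH : 0 ≤ H := by positivity
  have h3 : H - H * (1 + e) ^ 2 = H * (-(2 * e + e ^ 2)) := by ring
  rw [h3, abs_mul, abs_of_nonneg hH, abs_neg]
  have h4 : |2 * e + e ^ 2| ≤ 3 * ε := by
    rw [abs_le]; constructor <;> nlinarith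
  have h5 : 1 / 4 ≤ (1 + e) ^ 2 := by nlinarith
  calc H * |2 * e + e ^ 2| ≤ H * (3 * ε) := by gcongr
    _ = 12 * ε * (H * (1 / 4)) := by ring
    _ ≤ 12 * ε * (H * (1 + e) ^ 2) := by gcongr

end estimation

/-! ### Asymptotic efficiency of the maximum-likelihood estimator. -/

section asymptotics

variable {ι Ω : Type*} [MeasurableSpace Ω] {P : Measure Ω} [IsProbabilityMeasure P]
  {l : Filter ι} {r : ι → ℝ} {ν : Measure ℝ} [IsFiniteMeasure ν] {X : ι → Ω → TimeStamps}

/-- Asymptotic efficiency of the maximum-likelihood estimator of a location parameter, for Poisson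
processes of intensity `r • ν`, `r → ∞`. -/
theorem tendsto_mul_mle_error (hr : Tendsto r l atTop)
    (hX : ∀ᶠ i in l, HasLaw (X i) (poissonProcessLaw (ENNReal.ofReal (r i) • ν)) P)
    {L p q : ℝ → ℝ} (hL : ∀ u, HasDerivAt L (p u) u) (hp : ∀ u, HasDerivAt p (q u) u)
    {B : ℝ} (hLB : ∀ u, |L u| ≤ B) (hpB : ∀ u, |p u| ≤ B) (hqB : ∀ u, |q u| ≤ B)
    (hq : UniformContinuous q) {a b θ₀ J : ℝ} (hθ₀ : θ₀ ∈ Ioo a b) (hJ : 0 < J)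
    (hp0 : ∫ t, p (t - θ₀) ∂ν = 0) (hpJ : ∫ t, p (t - θ₀) ^ 2 ∂ν = J)
    (hqJ : ∫ t, q (t - θ₀) ∂ν = -J)
    (hneg : ∀ θ ∈ Icc a b, θ ≠ θ₀ → ∫ t, (L (t - θ) - L (t - θ₀)) ∂ν < 0)
    {θhat : ι → Ω → ℝ} (hmeas : ∀ᶠ i in l, AEMeasurable (θhat i) P)
    (hmem : ∀ᶠ i in l, ∀ᵐ ω ∂P, θhat i ω ∈ Icc a b)
    (hmax : ∀ᶠ i in l, ∀ᵐ ω ∂P,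
      IsMaxOn (fun θ => pointSum (fun t => L (t - θ)) (X i ω)) (Icc a b) (θhat i ω)) :
    Tendsto (fun i => r i * ∫ ω, (θhat i ω - θ₀) ^ 2 ∂P) l (𝓝 J⁻¹) := by
  have hLm : Measurable L := (continuous_iff_continuousAt.2 fun u => (hL u).continuousAt).measurable
  have hpm : Measurable p := (continuous_iff_continuousAt.2 fun u => (hp u).continuousAt).measurable
  have hqm : Measurable q := hq.continuous.measurable
  have hB0 : 0 ≤ B := (abs_nonneg _).trans (hLB 0)
  have hLip : ∀ θ θ' t, |L (t - θ) - L (t - θ')| ≤ B * |θ - θ'| := by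
    intro θ θ' t
    have := Convex.norm_image_sub_le_of_norm_hasDerivWithin_le (s := univ) (f := L) (f' := p)
      (C := B) (fun x _ => (hL x).hasDerivWithinAt) (fun x _ => hpB x) convex_univ
      (mem_univ (t - θ')) (mem_univ (t - θ))
    simp only [Real.norm_eq_abs] at this
    rwa [show t - θ - (t - θ') = -(θ - θ') by ring, abs_neg] at this
  -- the event on which the quadratic expansion holds
  have hgood : ∀ ε : ℝ, 0 < ε → ∃ A : ι → Set Ω, RateNegligible P l r A ∧
      ∀ᶠ i in l, ∀ᵐ ω ∂P, ω ∉ A i → ∃ c, |c + r i * J| ≤ ε * J * r i ∧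
        pointSum (fun t => p (t - θ₀)) (X i ω) = c * (θhat i ω - θ₀) := by
    intro ε hε
    set Q := ν.real univ with hQ
    have hQ0 : 0 ≤ Q := measureReal_nonneg
    -- The tolerance `ε * J * r` is split in two: this modulus, summed over at most `r * (Q + 1)`
    -- photons, costs one half, and the deviation of the curvature at `θ₀` costs the other.
    have hη : 0 < ε * J / (2 * (Q + 1)) := by positivity
    obtain ⟨δ₁, hδ₁, huc⟩ := Metric.uniformContinuous_iff.1 hq _ hη
    -- Small enough both for the modulus of `q` and for an error below `δ` to put the maximizer in
    -- the interior, where the score vanishes.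
    set δ := min (δ₁ / 2) (min (θ₀ - a) (b - θ₀)) with hδ
    have hδ0 : 0 < δ := by
      refine lt_min (by linarith) (lt_min ?_ ?_)
      · linarith [hθ₀.1]
      · linarith [hθ₀.2]
    have hδ1 : δ < δ₁ := (min_le_left _ _).trans_lt (by linarith)
    have hδa : δ ≤ θ₀ - a := (min_le_right _ _).trans (min_le_left _ _)
    have hδb : δ ≤ b - θ₀ := (min_le_right _ _).trans (min_le_right _ _)
    set S := Icc a b ∩ {θ | δ ≤ |θ - θ₀|} with hS
    have hSc : IsCompact S := isCompact_Icc.inter_right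
      (isClosed_le continuous_const (by fun_prop))
    have n1 := rateNegligible_of_isCompact hr hX (L := fun θ t => L (t - θ)) (θ₀ := θ₀) (B := B)
      (fun θ => by fun_prop) (fun θ x => hLB _) hB0 hLip hSc (fun θ hθ => hneg θ hθ.1 (by
        rintro rfl
        have h2 : δ ≤ |θ - θ| := hθ.2
        simp at h2; linarith))
    have n2 := rateNegligible_pointSum_deviation hr hX (f := fun t => q (t - θ₀)) (B := B)
      (by fun_prop) (fun x => hqB _) (by positivity : 0 < ε * J / 2)
    have n3 := rateNegligible_pointSum_deviation hr hX (f := fun _ => 1) (B := 1)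
      measurable_const (fun x => by simp) one_pos
    refine ⟨_, n1.union hr (n2.union hr n3), ?_⟩
    filter_upwards [hmem, hmax, hr.eventually_gt_atTop 0] with i h1 h2 hri
    filter_upwards [h1, h2] with ω w1 w2 hω
    simp only [mem_union, mem_ofPred_eq, not_or, not_le, integral_const, smul_eq_mul, mul_one,
      one_mul] at hω
    obtain ⟨g1, g2, g3⟩ := hω
    have hclose : |θhat i ω - θ₀| < δ := by
      by_contra hcon
      exact g1 ⟨θhat i ω, ⟨w1, not_lt.1 hcon⟩, w2 ⟨hθ₀.1.le, hθ₀.2.le⟩⟩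
    have hint : θhat i ω ∈ Ioo a b := by
      have := abs_lt.1 hclose
      constructor <;> linarith [this.1, this.2]
    obtain ⟨ξ, hξ, hW⟩ := exists_score_eq_mul hL hp (θ₀ := θ₀) hint (X i ω) w2
    refine ⟨_, ?_, hW⟩
    have hqq : ∀ t, |q (t - ξ) - q (t - θ₀)| ≤ ε * J / (2 * (Q + 1)) := by
      intro t
      refine (huc (a := t - ξ) (b := t - θ₀) ?_).le
      rw [Real.dist_eq, show t - ξ - (t - θ₀) = -(ξ - θ₀) by ring, abs_neg]
      linarith
    have h3 := abs_pointSum_sub_le hqq (X i ω)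
    have h4 : ε * J / (2 * (Q + 1)) * pointSum (fun _ => 1) (X i ω) ≤ ε * J / 2 * r i := by
      have : pointSum (fun _ => 1) (X i ω) ≤ r i * (Q + 1) := by
        linarith [(abs_lt.1 g3).2]
      calc _ ≤ ε * J / (2 * (Q + 1)) * (r i * (Q + 1)) := by gcongr
        _ = _ := by field_simp
    rw [hqJ] at g2
    have h5 := abs_le.1 h3
    have h6 := abs_lt.1 g2
    rw [abs_le]
    constructor <;> linarith [h5.1, h5.2, h6.1, h6.2]
  -- moments of the score
  set Y : ι → Ω → ℝ := fun i ω => pointSum (fun t => p (t - θ₀)) (X i ω) ^ 2 / r i with hY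
  -- The bound on the second moment of `Y` plays the part of uniform integrability.
  obtain ⟨C, hC⟩ : ∃ C : ℝ, ∀ᶠ i in l, Integrable (fun ω => Y i ω ^ 2) P ∧
      ∫ ω, Y i ω ^ 2 ∂P ≤ C := by
    refine ⟨48 * Real.exp (ν.real univ) * (max B 1) ^ 4, ?_⟩
    filter_upwards [hr.eventually_ge_atTop 1, hX] with i hi hXi
    have hi0 : 0 < r i := by linarith
    obtain ⟨h1, h2⟩ := pointSum_fourth_moment_le (f := fun t => p (t - θ₀)) (by fun_prop)
      (le_max_right B 1) (fun x => (hpB _).trans (le_max_left B 1)) hi hXi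
    simp only [hp0, mul_zero, sub_zero] at h1 h2
    have h3 : (fun ω => Y i ω ^ 2) =
        fun ω => pointSum (fun t => p (t - θ₀)) (X i ω) ^ 4 / r i ^ 2 := by
      funext ω; simp only [hY]; ring
    rw [h3, integral_div, div_le_iff₀ (by positivity)]
    exact ⟨h1.div_const _, h2⟩
  have hYint : ∀ᶠ i in l, Integrable (Y i) P ∧ ∫ ω, Y i ω ∂P = J := by
    filter_upwards [hC, hr.eventually_gt_atTop 0, hX] with i hCi hi hXi
    have : IsFiniteMeasure (ENNReal.ofReal (r i) • ν) :=
      Measure.smul_finite ν ENNReal.ofReal_ne_top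
    have hYm : AEStronglyMeasurable (Y i) P :=
      (((aemeasurable_pointSum_comp hXi (f := fun t => p (t - θ₀)) (by fun_prop)).pow_const
        2).div_const _).aestronglyMeasurable
    refine ⟨((integrable_const (1 : ℝ)).add hCi.1).mono' hYm (ae_of_all _ fun ω => ?_), ?_⟩
    · have hYn : 0 ≤ Y i ω := by simp only [hY]; positivity
      rw [Real.norm_of_nonneg hYn]
      simp only [Pi.add_apply]
      nlinarith [sq_nonneg (Y i ω - 1)]
    · have h1 := integral_pointSum_sq hXi (f := fun t => p (t - θ₀)) (B := B) (by fun_prop)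
        (fun x => hpB _)
      simp only [integral_smul_measure, hp0, hpJ, smul_eq_mul, mul_zero, sub_zero,
        ENNReal.toReal_ofReal hi.le] at h1
      simp only [hY]
      rw [integral_div, h1]
      field_simp
  have hC0 : ∀ᶠ i in l, 0 ≤ C := by
    filter_upwards [hC] with i hi
    exact (integral_nonneg fun ω => by positivity).trans hi.2
  -- the comparison of the error with the score
  set E := fun i => r i * ∫ ω, (θhat i ω - θ₀) ^ 2 ∂P with hE
  have hcomp : ∀ ε : ℝ, 0 < ε → ε ≤ 1 / 2 →
      ∀ᶠ i in l, |J ^ 2 * E i - J| ≤ ε * (12 * J + C + 1) := by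
    intro ε hε hε1
    obtain ⟨A, hA, hAg⟩ := hgood ε hε
    set D := (b - a) ^ 2 with hD
    -- The cost of the exceptional event: the squared error is at most `D` there, and `Y ≤ ε * Y ^ 2
    -- + 1 / (4 * ε)` leaves a constant multiple of the probability.
    have hAlim : Tendsto (fun i => J ^ 2 * D * (r i * P.real (A i)) +
        1 / (4 * ε) * (r i * P.real (A i))) l (𝓝 0) := by
      have := (hA.const_mul (J ^ 2 * D)).add (hA.const_mul (1 / (4 * ε)))
      simpa using this
    filter_upwards [hAg, hYint, hC, hmeas, hmem, hr.eventually_ge_atTop 1,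
      hAlim.eventually_lt_const hε] with i hAi hYi hCi hmi hmemi hri hAε
    have hri0 : 0 < r i := by linarith
    -- The exceptional event involves a union over uncountably many parameters and need not be
    -- measurable; a measurable hull of equal probability replaces it.
    set A' := toMeasurable P (A i) with hA'
    have hA'm : MeasurableSet A' := measurableSet_toMeasurable _ _
    have hA'P : P.real A' = P.real (A i) := by
      simp only [measureReal_def, hA', measure_toMeasurable]
    have hDb : ∀ᵐ ω ∂P, (θhat i ω - θ₀) ^ 2 ≤ D := by
      filter_upwards [hmemi] with ω hω
      rw [hD, ← sq_abs (θhat i ω - θ₀)]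
      refine pow_le_pow_left₀ (abs_nonneg _) ?_ 2
      rw [abs_le]; constructor <;> linarith [hω.1, hω.2, hθ₀.1, hθ₀.2]
    have hHint : Integrable (fun ω => (θhat i ω - θ₀) ^ 2) P :=
      Integrable.of_bound ((hmi.sub_const _).pow_const 2).aestronglyMeasurable D (by
        filter_upwards [hDb] with ω hω
        rwa [Real.norm_of_nonneg (sq_nonneg _)])
    have hpt : ∀ᵐ ω ∂P, |J ^ 2 * (r i * (θhat i ω - θ₀) ^ 2) - Y i ω| ≤
        12 * ε * Y i ω + ε * Y i ω ^ 2 +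
          A'.indicator (fun _ => J ^ 2 * (r i * D) + 1 / (4 * ε)) ω := by
      filter_upwards [hAi, hDb] with ω h1 h2
      have hYn : 0 ≤ Y i ω := by simp only [hY]; positivity
      by_cases hω : ω ∈ A'
      · rw [indicator_of_mem hω]
        have h3 : J ^ 2 * (r i * (θhat i ω - θ₀) ^ 2) ≤ J ^ 2 * (r i * D) := by gcongr
        have h4 : 0 ≤ J ^ 2 * (r i * (θhat i ω - θ₀) ^ 2) := by positivity
        have h5 : Y i ω ≤ ε * Y i ω ^ 2 + 1 / (4 * ε) := by
          have : ε * Y i ω ^ 2 + 1 / (4 * ε) - Y i ω = ε * (Y i ω - 1 / (2 * ε)) ^ 2 := by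
            field_simp; ring
          have h6 : 0 ≤ ε * (Y i ω - 1 / (2 * ε)) ^ 2 := by positivity
          linarith
        have h7 : 0 ≤ 12 * ε * Y i ω := by positivity
        rw [abs_le]; constructor <;> nlinarith
      · rw [indicator_of_notMem hω, add_zero]
        obtain ⟨c, hc, hW⟩ := h1 (fun h => hω (subset_toMeasurable _ _ h))
        have := abs_error_sub_score_le hJ hri0 hε hε1 hW hc
        have h8 : 0 ≤ ε * Y i ω ^ 2 := by positivity
        simp only [hY] at h8 ⊢
        linarith
    have i1 : Integrable (fun ω => J ^ 2 * (r i * (θhat i ω - θ₀) ^ 2)) P :=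
      (hHint.const_mul _).const_mul _
    have i2 : Integrable (fun ω => 12 * ε * Y i ω) P := hYi.1.const_mul _
    have i3 : Integrable (fun ω => ε * Y i ω ^ 2) P := hCi.1.const_mul _
    have i4 : Integrable (A'.indicator (fun _ => J ^ 2 * (r i * D) + 1 / (4 * ε))) P :=
      (integrable_const _).indicator hA'm
    have h5 : J ^ 2 * E i - J = ∫ ω, (J ^ 2 * (r i * (θhat i ω - θ₀) ^ 2) - Y i ω) ∂P := by
      rw [integral_sub i1 hYi.1, hYi.2, integral_const_mul, integral_const_mul]
    rw [h5]
    refine (abs_integral_le_integral_abs).trans ((integral_mono_ae (i1.sub hYi.1).abs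
      ((i2.add i3).add i4) hpt).trans ?_)
    rw [integral_add' (i2.add i3) i4, integral_add' i2 i3, integral_const_mul, integral_const_mul,
      integral_indicator_const _ hA'm, hYi.2, hA'P, smul_eq_mul]
    have h6 : 1 / (4 * ε) * P.real (A i) ≤ 1 / (4 * ε) * (r i * P.real (A i)) := by
      gcongr
      exact le_mul_of_one_le_left measureReal_nonneg hri
    have h7 := mul_le_mul_of_nonneg_left hCi.2 hε.le
    nlinarith
  have hlim : Tendsto (fun i => J ^ 2 * E i) l (𝓝 J) := by
    rw [Metric.tendsto_nhds]
    intro η hη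
    -- The sign of `C` is known only eventually along `l`, so it can be read off only if `l` is
    -- nontrivial.
    rcases l.eq_or_neBot with rfl | hne
    · simp
    obtain ⟨_, hCn⟩ := hC0.exists
    set Z := 12 * J + C + 1 with hZ
    have hZ0 : 0 < Z := by positivity
    have := hcomp (min (1 / 2) (η / (2 * Z))) (lt_min (by norm_num) (by positivity))
      (min_le_left _ _)
    filter_upwards [this] with i hi
    rw [Real.dist_eq]
    calc _ ≤ _ := hi
      _ ≤ η / (2 * Z) * Z := by gcongr; exact min_le_right _ _
      _ = η / 2 := by field_simp
      _ < η := by linarith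
  have := hlim.const_mul (J ^ 2)⁻¹
  have h1 : (J ^ 2)⁻¹ * J = J⁻¹ := by field_simp
  rw [h1] at this
  refine this.congr fun i => ?_
  rw [← mul_assoc, inv_mul_cancel₀ (by positivity), one_mul]

end asymptotics

/-! ### Mixtures of shifted pulses and their supports. -/

/-- The mixture of the shifts of `h` by the delays `-k y`, with weights `φ y`. -/
noncomputable def delayMixture (φ k h : ℝ → ℝ) (u : ℝ) : ℝ := ∫ y, φ y * h (u + k y)

section mixture

variable {φ k h : ℝ → ℝ}

lemma integrable_delayMixture (hφ : Integrable φ) (hk : Continuous k) (hh : Continuous h) {B : ℝ}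
    (hB : ∀ u, |h u| ≤ B) (u : ℝ) : Integrable fun y => φ y * h (u + k y) :=
  hφ.mul_bdd (c := B) (by fun_prop : Continuous fun y => h (u + k y)).aestronglyMeasurable
    (ae_of_all _ fun y => hB _)

lemma norm_mul_le_of_bounded {B : ℝ} (hB : ∀ u, |h u| ≤ B) (u y : ℝ) :
    ‖φ y * h (u + k y)‖ ≤ ‖φ y‖ * B := by
  rw [norm_mul]
  exact mul_le_mul_of_nonneg_left (hB _) (norm_nonneg _)

lemma hasDerivAt_delayMixture (hφ : Integrable φ) (hk : Continuous k) {h' : ℝ → ℝ}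
    (hh : ∀ u, HasDerivAt h (h' u) u) (hh' : Continuous h') {B B' : ℝ} (hB : ∀ u, |h u| ≤ B)
    (hB' : ∀ u, |h' u| ≤ B') (u : ℝ) :
    HasDerivAt (delayMixture φ k h) (delayMixture φ k h' u) u := by
  have hc : Continuous h := continuous_iff_continuousAt.2 fun u => (hh u).continuousAt
  refine (hasDerivAt_integral_of_dominated_loc_of_deriv_le (μ := volume)
    (F := fun u y => φ y * h (u + k y)) (F' := fun u y => φ y * h' (u + k y))
    (bound := fun y => ‖φ y‖ * B') (s := univ) univ_mem
    (Eventually.of_forall fun v => (integrable_delayMixture hφ hk hc hB v).aestronglyMeasurable)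
    (integrable_delayMixture hφ hk hc hB u)
    (integrable_delayMixture hφ hk hh' hB' u).aestronglyMeasurable
    (ae_of_all _ fun y v _ => norm_mul_le_of_bounded hB' v y) (hφ.norm.mul_const B')
    (ae_of_all _ fun y v _ => ?_)).2
  have := (hh (v + k y)).comp v ((hasDerivAt_id v).add_const (k y))
  simpa [Function.comp_def] using this.const_mul (φ y)

lemma continuous_delayMixture (hφ : Integrable φ) (hk : Continuous k) (hh : Continuous h) {B : ℝ}
    (hB : ∀ u, |h u| ≤ B) : Continuous (delayMixture φ k h) :=
  continuous_of_dominated (F := fun u y => φ y * h (u + k y)) (bound := fun y => ‖φ y‖ * B)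
    (fun u => (integrable_delayMixture hφ hk hh hB u).aestronglyMeasurable)
    (fun u => ae_of_all _ fun y => norm_mul_le_of_bounded hB u y) (hφ.norm.mul_const B)
    (ae_of_all _ fun y => by fun_prop)

/-- If a window carries the whole mass of the mixture, it carries the whole mass of almost every
shift that is mixed in. -/
lemma ae_eq_zero_of_setIntegral_delayMixture (hφ : Integrable φ) (hφ0 : ∀ y, 0 ≤ φ y)
    (hφ1 : ∫ y, φ y = 1) (hk : Continuous k) (hh : Continuous h) (hh0 : ∀ u, 0 ≤ h u)
    (hh1 : ∫ u, h u = 1) {c d : ℝ} (hwin : ∫ u in Icc c d, delayMixture φ k h u = 1) :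
    ∀ᵐ y, φ y ≠ 0 → ∀ u ∉ Icc c d, h (u + k y) = 0 := by
  -- A non-integrable function has integral zero by convention, so the value one forces
  -- integrability.
  have hint : Integrable h := by
    by_contra hcon
    rw [integral_undef hcon] at hh1
    norm_num at hh1
  have hshift : ∀ y, Integrable fun u => h (u + k y) := fun y => hint.comp_add_right (k y)
  have hshift1 : ∀ y, ∫ u, h (u + k y) = 1 := fun y => by
    rw [integral_add_right_eq_self h (k y), hh1]
  -- The mass that the window retains of each shift. It is at most one and its average with weights
  -- `φ` is one, so it equals one wherever `φ` is nonzero, up to a null set.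
  set m := fun y => ∫ u in Icc c d, h (u + k y) with hm
  have hm0 : ∀ y, 0 ≤ m y := fun y => integral_nonneg fun u => hh0 _
  have hm1 : ∀ y, m y ≤ 1 := fun y => by
    rw [← hshift1 y]
    exact setIntegral_le_integral (hshift y) (ae_of_all _ fun u => hh0 _)
  have hmeas : AEStronglyMeasurable (fun z : ℝ × ℝ => φ z.2 * h (z.1 + k z.2))
      ((volume.restrict (Icc c d)).prod volume) :=
    (AEStronglyMeasurable.comp_snd hφ.aestronglyMeasurable).mul
      (by fun_prop : Continuous fun z : ℝ × ℝ => h (z.1 + k z.2)).aestronglyMeasurable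
  have hnorm : ∀ y, ∫ u in Icc c d, ‖φ y * h (u + k y)‖ = φ y * m y := fun y => by
    rw [← integral_const_mul]
    congr 1; funext u
    rw [Real.norm_of_nonneg (mul_nonneg (hφ0 _) (hh0 _))]
  have hmm : AEStronglyMeasurable (fun y => φ y * m y) := by
    have := hmeas.norm.prod_swap.integral_prod_right'
    simpa only [Prod.fst_swap, Prod.snd_swap, hnorm] using this
  have hφm : Integrable fun y => φ y * m y := hφ.mono' hmm (ae_of_all _ fun y => by
    rw [Real.norm_of_nonneg (mul_nonneg (hφ0 _) (hm0 _))]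
    exact mul_le_of_le_one_right (hφ0 y) (hm1 y))
  have hprod : Integrable (fun z : ℝ × ℝ => φ z.2 * h (z.1 + k z.2))
      ((volume.restrict (Icc c d)).prod volume) := by
    rw [integrable_prod_iff' hmeas]
    refine ⟨ae_of_all _ fun y => ((hshift y).integrableOn (s := Icc c d)).const_mul (φ y), ?_⟩
    simpa only [hnorm] using hφm
  have hone : ∫ y, φ y * m y = 1 := by
    have hsw := integral_integral_swap (f := fun u y => φ y * h (u + k y)) hprod
    rw [← hwin]
    simp only [delayMixture]
    rw [hsw]
    congr 1; funext y
    rw [integral_const_mul]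
  have hz : ∀ᵐ y, φ y - φ y * m y = 0 := by
    have h0 : ∫ y, (φ y - φ y * m y) = 0 := by
      rw [integral_sub hφ hφm, hφ1, hone, sub_self]
    exact (integral_eq_zero_iff_of_nonneg (fun y => by
      have := mul_le_of_le_one_right (hφ0 y) (hm1 y)
      simpa using this) (hφ.sub hφm)).1 h0
  filter_upwards [hz] with y hy hne u hu
  have hmy : m y = 1 := by
    have : φ y * (1 - m y) = 0 := by linarith
    rcases mul_eq_zero.1 this with h | h
    · exact absurd h hne
    · linarith
  have hcompl : ∫ u in (Icc c d)ᶜ, h (u + k y) = 0 := by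
    have := integral_add_compl (measurableSet_Icc (a := c) (b := d)) (hshift y)
    rw [hshift1 y] at this
    simp only [hm] at hmy
    linarith
  rw [setIntegral_eq_zero_iff_of_nonneg_ae (ae_of_all _ fun u => hh0 _)
    (hshift y).integrableOn] at hcompl
  -- Continuity upgrades almost everywhere to everywhere on the open complement of the window.
  have := Measure.eqOn_open_of_ae_eq hcompl isClosed_Icc.isOpen_compl
    (by fun_prop : Continuous fun u => h (u + k y)).continuousOn continuousOn_const
  exact this hu

/-- Since `φ` has integral one, it is nonzero on a set of positive measure, so at least one shift
confined to the window is available. -/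
lemma hasCompactSupport_of_ae_shift (hφ1 : ∫ y, φ y = 1) {c d : ℝ}
    (hae : ∀ᵐ y, φ y ≠ 0 → ∀ u ∉ Icc c d, h (u + k y) = 0) : HasCompactSupport h := by
  have : ∃ y, φ y ≠ 0 ∧ (φ y ≠ 0 → ∀ u ∉ Icc c d, h (u + k y) = 0) := by
    refine Frequently.exists (f := ae volume) (Frequently.and_eventually ?_ hae)
    intro hcon
    have : φ =ᵐ[volume] fun _ => 0 := by
      filter_upwards [hcon] with y hy
      exact not_not.1 hy
    rw [integral_congr_ae this] at hφ1
    simp at hφ1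
  obtain ⟨y, hy, hy'⟩ := this
  refine HasCompactSupport.intro (K := Icc (c + k y) (d + k y)) isCompact_Icc fun x hx => ?_
  have := hy' hy (x - k y) (fun hc => hx ⟨by linarith [hc.1], by linarith [hc.2]⟩)
  rwa [sub_add_cancel] at this

lemma delayMixture_eq_zero {c d : ℝ}
    (hae : ∀ᵐ y, φ y ≠ 0 → ∀ u ∉ Icc c d, h (u + k y) = 0) {u : ℝ} (hu : u ∉ Icc c d) :
    delayMixture φ k h u = 0 := by
  refine integral_eq_zero_of_ae ?_
  filter_upwards [hae] with y hy
  by_cases h0 : φ y = 0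
  · simp [h0]
  · simp [hy h0 u hu]

end mixture

/-! ### The effective pulse as a mixture. -/

section effective

variable {s φ τ : ℝ → ℝ} {N : ℕ}

lemma effPulse_eq_delayMixture (n : Fin N) :
    effPulse φ s τ N n =
      delayMixture φ (fun y => τ (pixelMid N n) - τ (pixelMid N n - y)) s := by
  funext u
  simp only [effPulse, effIntensity, spatialConv, convolution, returnPulse, delayMixture,
    ContinuousLinearMap.mul_apply', one_mul, add_zero, add_sub_assoc]

/-- A bounded pulse lets the convolution integral be split, and a kernel of mass one leaves the
constant floor unchanged. -/
lemma effIntensity_eq_of_bounded (hφ : Integrable φ) (hφ1 : ∫ y, φ y = 1) (hτ : Continuous τ)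
    (hs : Continuous s) {B : ℝ} (hB : ∀ u, |s u| ≤ B) (α lamb : ℝ) (n : Fin N) (t : ℝ) :
    effIntensity φ α lamb s τ N n t =
      α * effPulse φ s τ N n (t - τ (pixelMid N n)) + lamb := by
  have hi := integrable_delayMixture hφ
    (k := fun y => τ (pixelMid N n) - τ (pixelMid N n - y)) (by fun_prop) hs hB
    (t - τ (pixelMid N n))
  rw [effPulse_eq_delayMixture, delayMixture, ← integral_const_mul]
  simp only [effIntensity, spatialConv, convolution, returnPulse, ContinuousLinearMap.mul_apply']
  have h1 : ∀ y, φ y * (α * s (t - τ (pixelMid N n - y)) + lamb) =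
      α * (φ y * s (t - τ (pixelMid N n) + (τ (pixelMid N n) - τ (pixelMid N n - y)))) +
        φ y * lamb := by
    intro y
    rw [sub_add_sub_cancel]; ring
  simp_rw [h1]
  rw [integral_add (hi.const_mul α) (hφ.mul_const lamb), integral_mul_const, hφ1, one_mul]

end effective

lemma HasDerivAt.eq_zero_of_eqOn_compl_Icc {f : ℝ → ℝ} {f' u c d : ℝ} (hf : HasDerivAt f f' u)
    (h0 : ∀ v ∉ Icc c d, f v = 0) (hu : u ∉ Icc c d) : f' = 0 := by
  have h1 : f =ᶠ[𝓝 u] fun _ => 0 := by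
    filter_upwards [isClosed_Icc.isOpen_compl.mem_nhds hu] with v hv
    exact h0 v hv
  exact (hf.congr_of_eventuallyEq h1.symm).unique (hasDerivAt_const u 0)

lemma intervalIntegral_comp_sub_eq_integral {f : ℝ → ℝ} {T θ : ℝ} (hT : 0 < T)
    (h0 : ∀ v ∉ Icc (-T - θ) (T - θ), f v = 0) : ∫ t in (-T)..T, f (t - θ) = ∫ u, f u := by
  rw [intervalIntegral.integral_of_le (by linarith), ← integral_Icc_eq_integral_Ioc,
    setIntegral_eq_integral_of_forall_compl_eq_zero, integral_sub_right_eq_self f θ]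
  intro t ht
  exact h0 _ fun hc => ht ⟨by linarith [hc.1], by linarith [hc.2]⟩

lemma exists_bound_of_eqOn_compl_Icc {f : ℝ → ℝ} {c d e : ℝ} (hf : Continuous f)
    (h0 : ∀ v ∉ Icc c d, f v = e) : ∃ B, ∀ u, |f u| ≤ B := by
  obtain ⟨B, hB⟩ := isCompact_Icc.exists_bound_of_continuousOn (s := Icc c d) hf.continuousOn
  refine ⟨max B |e|, fun u => ?_⟩
  by_cases hu : u ∈ Icc c d
  · exact (hB u hu).trans (le_max_left _ _)
  · rw [h0 u hu]; exact le_max_right _ _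

/-- With floor `β * α` the numerator scales as `α ^ 2` and the denominator as `α`. -/
lemma fisherIntegral_scale (g : ℝ → ℝ) (T β : ℝ) {α : ℝ} (hα : 0 < α) :
    fisherIntegral T α (β * α) g = α * fisherIntegral T 1 β g := by
  simp only [fisherIntegral, one_mul]
  rw [← intervalIntegral.integral_const_mul]
  congr 1; funext t
  rw [show α * g t + β * α = α * (g t + β) by ring, mul_pow, sq α, mul_assoc,
    mul_div_mul_left _ _ hα.ne', mul_div_assoc]

/-! ### Pulses supported in the window, and the estimation of their delay. -/

/-- A twice continuously differentiable pulse which, shifted by any delay of `{0} ∪ [a, b]`, is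
normalized and supported on the window `[-T, T]`. -/
structure WindowedPulse (g g' g'' : ℝ → ℝ) (T a b : ℝ) : Prop where
  nonneg : ∀ u, 0 ≤ g u
  hasDerivAt : ∀ u, HasDerivAt g (g' u) u
  hasDerivAt' : ∀ u, HasDerivAt g' (g'' u) u
  continuous'' : Continuous g''
  normalized : ∀ θ ∈ insert 0 (Icc a b), ∫ t in (-T)..T, g (t - θ) = 1
  support : ∀ θ ∈ insert 0 (Icc a b), ∀ u ∉ Icc (-T - θ) (T - θ), g u = 0

namespace WindowedPulse

variable {g g' g'' : ℝ → ℝ} {T a b : ℝ}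

section

variable (hg : WindowedPulse g g' g'' T a b)
include hg

lemma continuous : Continuous g :=
  continuous_iff_continuousAt.2 fun u => (hg.hasDerivAt u).continuousAt

lemma continuous' : Continuous g' :=
  continuous_iff_continuousAt.2 fun u => (hg.hasDerivAt' u).continuousAt

lemma support_zero : ∀ u ∉ Icc (-T) T, g u = 0 := by
  intro u hu
  exact hg.support 0 (mem_insert _ _) u (by simpa using hu)

lemma support_deriv {c d : ℝ} (h0 : ∀ u ∉ Icc c d, g u = 0) : ∀ u ∉ Icc c d, g' u = 0 :=
  fun u hu => (hg.hasDerivAt u).eq_zero_of_eqOn_compl_Icc h0 hu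

lemma support_deriv_deriv {c d : ℝ} (h0 : ∀ u ∉ Icc c d, g u = 0) : ∀ u ∉ Icc c d, g'' u = 0 :=
  fun u hu => (hg.hasDerivAt' u).eq_zero_of_eqOn_compl_Icc (hg.support_deriv h0) hu

/-- At an interior delay, the pulse stays away from the boundary of the window. -/
lemma eq_zero_of_mem_Ioo {θ : ℝ} (hθ : θ ∈ Ioo a b) :
    ∀ u ∉ Icc (-T - a) (T - b), g u = 0 := by
  intro u hu
  have hab : a ≤ b := (hθ.1.trans hθ.2).le
  by_cases h : -T - a ≤ u
  · refine hg.support b (mem_insert_of_mem _ ⟨hab, le_rfl⟩) u fun hc => hu ⟨h, hc.2⟩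
  · refine hg.support a (mem_insert_of_mem _ ⟨le_rfl, hab⟩) u fun hc => h hc.1

lemma integral_eq_one (hT : 0 < T) : ∫ u, g u = 1 := by
  rw [← hg.normalized 0 (mem_insert _ _), intervalIntegral_comp_sub_eq_integral hT
    (hg.support 0 (mem_insert _ _))]

lemma exists_deriv_ne_zero (hT : 0 < T) : ∃ u ∈ Icc (-T) T, g' u ≠ 0 := by
  by_contra! hcon
  have h0 : ∀ u, g' u = 0 := fun u => by
    by_cases hu : u ∈ Icc (-T) T
    · exact hcon u hu
    · exact hg.support_deriv hg.support_zero u hu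
  have hconst : ∀ u, g u = 0 := fun u => by
    rw [is_const_of_deriv_eq_zero (fun x => (hg.hasDerivAt x).differentiableAt)
      (fun x => by rw [(hg.hasDerivAt x).deriv, h0]) u (T + 1)]
    exact hg.support_zero _ fun hc => by linarith [hc.2]
  have := hg.integral_eq_one hT
  simp [hconst] at this

lemma add_pos {β : ℝ} (hβ : 0 < β) (u : ℝ) : 0 < g u + β := by
  linarith [hg.nonneg u]

lemma continuous_info {β : ℝ} (hβ : 0 < β) : Continuous fun u => g' u ^ 2 / (g u + β) :=
  (hg.continuous'.pow 2).div (hg.continuous.add continuous_const) fun u => (hg.add_pos hβ u).ne'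

lemma info_eq_zero {β : ℝ} {c d : ℝ} (h0 : ∀ u ∉ Icc c d, g u = 0) :
    ∀ u ∉ Icc c d, g' u ^ 2 / (g u + β) = 0 := fun u hu => by
  rw [hg.support_deriv h0 u hu]; simp

/-- As an integral over the whole line, the information no longer depends on the delay at which the
pulse is placed. This links the integral centred at zero to the true delay. -/
lemma fisherIntegral_one (hT : 0 < T) (β : ℝ) :
    fisherIntegral T 1 β g = ∫ u, g' u ^ 2 / (g u + β) := by
  have h1 := intervalIntegral_comp_sub_eq_integral (f := fun u => g' u ^ 2 / (g u + β)) (θ := 0) hT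
    (hg.info_eq_zero (hg.support 0 (mem_insert _ _)))
  rw [← h1]
  simp only [fisherIntegral, one_mul, sub_zero]
  congr 1; funext t
  rw [(hg.hasDerivAt t).deriv]

lemma fisherIntegral_one_pos (hT : 0 < T) {β : ℝ} (hβ : 0 < β) : 0 < fisherIntegral T 1 β g := by
  have hf : (fun t => (1 * deriv g t) ^ 2 / (1 * g t + β)) = fun u => g' u ^ 2 / (g u + β) := by
    funext t
    rw [(hg.hasDerivAt t).deriv, one_mul, one_mul]
  rw [fisherIntegral, hf]
  obtain ⟨u, hu, hne⟩ := hg.exists_deriv_ne_zero hT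
  refine intervalIntegral.integral_pos (by linarith) (hg.continuous_info hβ).continuousOn
    (fun x _ => div_nonneg (sq_nonneg _) (hg.add_pos hβ x).le) ⟨u, hu, ?_⟩
  exact div_pos (by positivity) (hg.add_pos hβ u)

/-- Distinct delays give distinct pulses. -/
lemma exists_shift_ne (hT : 0 < T) {θ θ₀ : ℝ} (hθ : θ ∈ Icc a b) (hθ₀ : θ₀ ∈ Icc a b)
    (hne : θ ≠ θ₀) : ∃ t ∈ Icc (-T) T, g (t - θ) ≠ g (t - θ₀) := by
  by_contra! hcon
  have hall : ∀ t, g (t - θ) = g (t - θ₀) := fun t => by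
    by_cases ht : t ∈ Icc (-T) T
    · exact hcon t ht
    · rw [hg.support θ (mem_insert_of_mem _ hθ) (t - θ)
          (fun hc => ht ⟨by linarith [hc.1], by linarith [hc.2]⟩),
        hg.support θ₀ (mem_insert_of_mem _ hθ₀) (t - θ₀)
          (fun hc => ht ⟨by linarith [hc.1], by linarith [hc.2]⟩)]
  -- Pulses that agree on the window agree everywhere, so `g` would have a nonzero period; with
  -- bounded support it would then vanish, against its mass one.
  have hper : Function.Periodic g (θ - θ₀) := fun u => by
    have := hall (u + θ)
    rw [add_sub_cancel_right] at this
    rw [this]; congr 1; ring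
  have hd : 0 < |θ - θ₀| := abs_pos.2 (sub_ne_zero.2 hne)
  have hzero : ∀ u, g u = 0 := fun u => by
    obtain ⟨n, hn⟩ := exists_nat_gt ((T + |u|) / |θ - θ₀|)
    rw [div_lt_iff₀ hd] at hn
    have h1 := hper.nat_mul n u
    rw [← h1]
    refine hg.support_zero _ fun hc => ?_
    have h2 : |u + n * (θ - θ₀)| ≤ T := abs_le.2 hc
    have h3 : |(n : ℝ) * (θ - θ₀)| = n * |θ - θ₀| := by rw [abs_mul, Nat.abs_cast]
    have h4 : |(n : ℝ) * (θ - θ₀)| ≤ |u + n * (θ - θ₀)| + |u| := by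
      have := abs_sub (u + n * (θ - θ₀)) u
      rwa [add_sub_cancel_left] at this
    linarith
  have := hg.integral_eq_one hT
  simp [hzero] at this

end

end WindowedPulse

/-- The intensity measure on the window at unit signal level, for the delay `θ`. -/
noncomputable def windowMeasure (g : ℝ → ℝ) (T β θ : ℝ) : Measure ℝ :=
  (volume.restrict (Icc (-T) T)).withDensity fun t => ENNReal.ofReal (g (t - θ) + β)

namespace WindowedPulse

variable {g g' g'' : ℝ → ℝ} {T a b β : ℝ} (hg : WindowedPulse g g' g'' T a b)
include hg

lemma isFiniteMeasure_windowMeasure (β θ : ℝ) : IsFiniteMeasure (windowMeasure g T β θ) := by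
  have hc := hg.continuous
  have : IntegrableOn (fun t => g (t - θ) + β) (Icc (-T) T) :=
    (by fun_prop : Continuous fun t => g (t - θ) + β).integrableOn_Icc
  exact isFiniteMeasure_withDensity_ofReal this.2

lemma integral_windowMeasure (hT : 0 < T) (hβ : 0 < β) (θ : ℝ) (f : ℝ → ℝ) :
    ∫ t, f t ∂windowMeasure g T β θ = ∫ t in (-T)..T, (g (t - θ) + β) * f t := by
  have hc := hg.continuous
  rw [windowMeasure, integral_withDensity_eq_integral_toReal_smul (by fun_prop)
    (ae_of_all _ fun _ => ENNReal.ofReal_lt_top), intervalIntegral.integral_of_le (by linarith),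
    ← integral_Icc_eq_integral_Ioc]
  congr 1; funext t
  rw [ENNReal.toReal_ofReal (hg.add_pos hβ _).le, smul_eq_mul]

/-- The reduction to a fixed measure scaled by the signal level, possible because the floor is a
fixed multiple of that level. -/
lemma timeStampLaw_eq {α : ℝ} (hα : 0 < α) (θ : ℝ) {lam : ℝ → ℝ}
    (hlam : ∀ t, lam t = α * g (t - θ) + β * α) :
    timeStampLaw T lam = poissonProcessLaw (ENNReal.ofReal α • windowMeasure g T β θ) := by
  have hc := hg.continuous
  rw [timeStampLaw, windowMeasure, ← withDensity_smul _ (by fun_prop)]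
  congr 2; funext t
  rw [hlam, Pi.smul_apply, smul_eq_mul, ← ENNReal.ofReal_mul hα.le]
  congr 1; ring

/-- The divergence of a wrong delay from the true one is positive. -/
lemma integral_log_ratio_neg (hT : 0 < T) (hβ : 0 < β) {θ θ₀ : ℝ} (hθ : θ ∈ Icc a b)
    (hθ₀ : θ₀ ∈ Icc a b) (hne : θ ≠ θ₀) :
    ∫ t, (Real.log (g (t - θ) + β) - Real.log (g (t - θ₀) + β)) ∂windowMeasure g T β θ₀ < 0 := by
  have hc := hg.continuous
  have hcs : ∀ θ, Continuous fun t => g (t - θ) := fun θ => by fun_prop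
  have hlog : ∀ θ, Continuous fun t => Real.log (g (t - θ) + β) := fun θ =>
    (by fun_prop : Continuous fun t => g (t - θ) + β).log fun t => (hg.add_pos hβ _).ne'
  rw [hg.integral_windowMeasure hT hβ]
  have hz : ∫ t in (-T)..T, (g (t - θ) - g (t - θ₀)) = 0 := by
    rw [intervalIntegral.integral_sub ((hcs θ).intervalIntegrable _ _)
      ((hcs θ₀).intervalIntegrable _ _), hg.normalized θ (mem_insert_of_mem _ hθ),
      hg.normalized θ₀ (mem_insert_of_mem _ hθ₀), sub_self]
  -- Zero is replaced by the difference of the two equal masses. The integrands then compare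
  -- pointwise by `log x ≤ x - 1` at the ratio of intensities, strictly where the shifted pulses
  -- differ.
  rw [← hz]
  have hlogdiv : ∀ t, Real.log (g (t - θ) + β) - Real.log (g (t - θ₀) + β) =
      Real.log ((g (t - θ) + β) / (g (t - θ₀) + β)) := fun t => by
    rw [Real.log_div (hg.add_pos hβ _).ne' (hg.add_pos hβ _).ne']
  have hrhs : ∀ t, g (t - θ) - g (t - θ₀) =
      (g (t - θ₀) + β) * ((g (t - θ) + β) / (g (t - θ₀) + β) - 1) := fun t => by
    have := (hg.add_pos hβ (t - θ₀)).ne'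
    field_simp; ring
  obtain ⟨t, ht, htne⟩ := hg.exists_shift_ne hT hθ hθ₀ hne
  refine intervalIntegral.integral_lt_integral_of_continuousOn_of_le_of_exists_lt (by linarith)
    (((hcs θ₀).add continuous_const).mul ((hlog θ).sub (hlog θ₀))).continuousOn
    ((hcs θ).sub (hcs θ₀)).continuousOn ?_ ⟨t, ht, ?_⟩
  · intro x _
    rw [hlogdiv, hrhs]
    exact mul_le_mul_of_nonneg_left (Real.log_le_sub_one_of_pos
      (div_pos (hg.add_pos hβ _) (hg.add_pos hβ _))) (hg.add_pos hβ _).le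
  · rw [hlogdiv, hrhs]
    refine mul_lt_mul_of_pos_left (Real.log_lt_sub_one_of_pos
      (div_pos (hg.add_pos hβ _) (hg.add_pos hβ _)) ?_) (hg.add_pos hβ _)
    rw [Ne, div_eq_one_iff_eq (hg.add_pos hβ _).ne']
    intro h; exact htne (by linarith)

/-- Asymptotic efficiency of the maximum-likelihood estimator of the delay of a pulse. -/
theorem tendsto_mul_pixelError {ι Ω : Type*} [MeasurableSpace Ω] {P : Measure Ω}
    [IsProbabilityMeasure P] {l : Filter ι} {r : ι → ℝ} (hr : Tendsto r l atTop)
    {X : ι → Ω → TimeStamps} {θhat : ι → Ω → ℝ} {θ₀ : ℝ} (hT : 0 < T) (hβ : 0 < β)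
    (hθ₀ : θ₀ ∈ Ioo a b)
    (hX : ∀ᶠ i in l,
      HasLaw (X i) (poissonProcessLaw (ENNReal.ofReal (r i) • windowMeasure g T β θ₀)) P)
    (hmeas : ∀ᶠ i in l, AEMeasurable (θhat i) P)
    (hmle : ∀ᶠ i in l, ∀ᵐ ω ∂P, IsMLE (r i) (β * r i) g (Icc a b) (X i ω) (θhat i ω)) :
    Tendsto (fun i => r i * pixelError P (θhat i) θ₀) l (𝓝 (fisherIntegral T 1 β g)⁻¹) := by
  have hc := hg.continuous
  have hc' := hg.continuous'
  have hc'' := hg.continuous''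
  have hpos := hg.add_pos hβ
  have := hg.isFiniteMeasure_windowMeasure β θ₀
  have hθ₀' : θ₀ ∈ Icc a b := Ioo_subset_Icc_self hθ₀
  set L : ℝ → ℝ := fun u => Real.log (g u + β) with hL
  set p : ℝ → ℝ := fun u => g' u / (g u + β) with hp
  set q : ℝ → ℝ := fun u => g'' u / (g u + β) - g' u ^ 2 / (g u + β) ^ 2 with hq
  have hLd : ∀ u, HasDerivAt L (p u) u := fun u =>
    ((hg.hasDerivAt u).add_const β).log (hpos u).ne'
  have hpd : ∀ u, HasDerivAt p (q u) u := fun u => by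
    have h1 := (hg.hasDerivAt' u).div ((hg.hasDerivAt u).add_const β) (hpos u).ne'
    refine h1.congr_deriv ?_
    have := (hpos u).ne'
    simp only [hq]; field_simp
  have hLc : Continuous L := continuous_iff_continuousAt.2 fun u => (hLd u).continuousAt
  have hpc : Continuous p := continuous_iff_continuousAt.2 fun u => (hpd u).continuousAt
  have hqc : Continuous q := by
    refine (hc''.div (by fun_prop) fun u => (hpos u).ne').sub
      ((hc'.pow 2).div (by fun_prop) fun u => (pow_pos (hpos u) 2).ne')
  have h0 := hg.support_zero
  have h0' := hg.support_deriv h0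
  have h0'' := hg.support_deriv_deriv h0
  have hq0 : ∀ u ∉ Icc (-T) T, q u = 0 := fun u hu => by
    simp only [hq]; rw [h0' u hu, h0'' u hu]; simp
  obtain ⟨B₁, hB₁⟩ := exists_bound_of_eqOn_compl_Icc (c := -T) (d := T) (e := Real.log β) hLc
    (fun u hu => by simp only [hL]; rw [h0 u hu, zero_add])
  obtain ⟨B₂, hB₂⟩ := exists_bound_of_eqOn_compl_Icc (c := -T) (d := T) (e := 0) hpc
    (fun u hu => by simp only [hp]; rw [h0' u hu, zero_div])
  obtain ⟨B₃, hB₃⟩ := exists_bound_of_eqOn_compl_Icc hqc hq0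
  set B := max B₁ (max B₂ B₃)
  have hquc : UniformContinuous q :=
    (HasCompactSupport.intro isCompact_Icc hq0).uniformContinuous_of_continuous hqc
  -- Because `θ₀` is interior to `[a, b]`, the pulse and its derivatives vanish at both ends of the
  -- window, so derivatives integrate to zero over it.
  have hedge := hg.eq_zero_of_mem_Ioo hθ₀
  have hright : T - θ₀ ∉ Icc (-T - a) (T - b) := fun hh => by linarith [hh.2, hθ₀.2]
  have hleft : -T - θ₀ ∉ Icc (-T - a) (T - b) := fun hh => by linarith [hh.1, hθ₀.1]
  have hcomp : ∀ {f f' : ℝ → ℝ}, (∀ u, HasDerivAt f (f' u) u) → Continuous f' →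
      f (T - θ₀) = 0 → f (-T - θ₀) = 0 → ∫ t in (-T)..T, f' (t - θ₀) = 0 := by
    intro f f' hf hf' h1 h2
    rw [intervalIntegral.integral_comp_sub_right f' θ₀,
      intervalIntegral.integral_eq_sub_of_hasDerivAt (fun u _ => hf u)
      (hf'.intervalIntegrable _ _), h1, h2, sub_zero]
  have hinfo : ∫ t in (-T)..T, g' (t - θ₀) ^ 2 / (g (t - θ₀) + β) =
      fisherIntegral T 1 β g := by
    rw [hg.fisherIntegral_one hT β]
    exact intervalIntegral_comp_sub_eq_integral (f := fun u => g' u ^ 2 / (g u + β)) hT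
      (hg.info_eq_zero (hg.support θ₀ (mem_insert_of_mem _ hθ₀')))
  refine tendsto_mul_mle_error (ν := windowMeasure g T β θ₀) (a := a) (b := b) (B := B) hr hX
    hLd hpd (fun u => (hB₁ u).trans (le_max_left _ _))
    (fun u => (hB₂ u).trans ((le_max_left _ _).trans (le_max_right _ _)))
    (fun u => (hB₃ u).trans ((le_max_right _ _).trans (le_max_right _ _))) hquc hθ₀
    (hg.fisherIntegral_one_pos hT hβ) ?_ ?_ ?_
    (fun θ hθ hne => hg.integral_log_ratio_neg hT hβ hθ hθ₀' hne) hmeas ?_ ?_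
  -- Against the true density the score integrand is `(g + β) * p = g'`, so the score is centred.
  · rw [hg.integral_windowMeasure hT hβ]
    rw [← hcomp hg.hasDerivAt hc' (hedge _ hright) (hedge _ hleft)]
    congr 1; funext t
    have := (hpos (t - θ₀)).ne'
    simp only [hp]; field_simp
  · rw [hg.integral_windowMeasure hT hβ, ← hinfo]
    congr 1; funext t
    have := (hpos (t - θ₀)).ne'
    simp only [hp]; field_simp
  -- Here `(g + β) * q` is `g''` minus the information density, and `g''` integrates to zero.
  · rw [hg.integral_windowMeasure hT hβ, ← hinfo]
    have h2 := hcomp hg.hasDerivAt' hc'' (hg.support_deriv hedge _ hright)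
      (hg.support_deriv hedge _ hleft)
    have h3 : ∀ t, (g (t - θ₀) + β) * q (t - θ₀) =
        g'' (t - θ₀) - g' (t - θ₀) ^ 2 / (g (t - θ₀) + β) := fun t => by
      have := (hpos (t - θ₀)).ne'
      simp only [hq]; field_simp
    have h4 : Continuous fun t => g' (t - θ₀) ^ 2 / (g (t - θ₀) + β) :=
      (hg.continuous_info hβ).comp (continuous_id.sub continuous_const)
    simp_rw [h3]
    rw [intervalIntegral.integral_sub
      ((by fun_prop : Continuous fun t => g'' (t - θ₀)).intervalIntegrable _ _)
      (h4.intervalIntegrable _ _), h2, zero_sub]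
  · filter_upwards [hmle] with i hi
    filter_upwards [hi] with ω hω using hω.1
  · filter_upwards [hmle, hr.eventually_gt_atTop 0] with i hi hri
    filter_upwards [hi] with ω hω
    -- The factor `r` leaves the logarithm as a term that depends on the photon count but not on
    -- `θ`, so the maximizers are the same.
    have hlik : ∀ θ, logLik (r i) (β * r i) g (X i ω) θ =
        (X i ω).1 * Real.log (r i) + pointSum (fun t => L (t - θ)) (X i ω) := fun θ => by
      simp only [logLik, pointSum, hL]
      have : ∀ j, Real.log (r i * g ((X i ω).2 j - θ) + β * r i) =
          Real.log (r i) + Real.log (g ((X i ω).2 j - θ) + β) := fun j => by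
        rw [← Real.log_mul hri.ne' (hpos _).ne']; congr 1; ring
      simp_rw [this]
      rw [Finset.sum_add_distrib]; simp
    intro θ hθ
    have h4 : logLik (r i) (β * r i) g (X i ω) θ ≤ logLik (r i) (β * r i) g (X i ω) (θhat i ω) :=
      hω.2 hθ
    rw [hlik, hlik] at h4
    exact le_of_add_le_add_left h4

end WindowedPulse

/-! ### Integration over the pixels. -/

section pixels

variable {N : ℕ}

/-- The interior of a pixel. -/
def pixelInterior (N : ℕ) (n : Fin N) : Set ℝ := Ioo ((n : ℝ) / N) (((n : ℝ) + 1) / N)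

/-- The boxcars are closed, so neighbouring ones overlap at a shared endpoint. The formula therefore
needs open pixels; the endpoints are null for integration. -/
lemma boxcar_pixel {n : Fin N} {x : ℝ} (hx : x ∈ pixelInterior N n) (m : Fin N) :
    boxcar (N * x - m) = if m = n then 1 else 0 := by
  have hN : (0 : ℝ) < N := Nat.cast_pos.2 n.pos
  obtain ⟨h1, h2⟩ := hx
  rw [div_lt_iff₀ hN] at h1
  rw [lt_div_iff₀ hN] at h2
  rw [boxcar, indicator_apply]
  congr 1
  rw [eq_iff_iff, mem_Icc]
  constructor
  · rintro ⟨h3, h4⟩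
    have h5 : (m : ℝ) < n + 1 := by linarith
    have h6 : (n : ℝ) < m + 1 := by linarith
    norm_cast at h5 h6
    exact Fin.ext (by omega)
  · rintro rfl
    constructor <;> linarith

lemma sum_mul_boxcar {n : Fin N} {x : ℝ} (hx : x ∈ pixelInterior N n) (w : Fin N → ℝ) :
    ∑ m, w m * boxcar (N * x - m) = w n := by
  simp [boxcar_pixel hx]

lemma reconstruct_pixel {n : Fin N} {x : ℝ} (hx : x ∈ pixelInterior N n) (v : Fin N → ℝ) :
    reconstruct N v x = v n := sum_mul_boxcar hx v

lemma linearized_pixel {n : Fin N} {x : ℝ} (hx : x ∈ pixelInterior N n) (τ : ℝ → ℝ) :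
    linearized N τ x =
      τ (pixelMid N n) + deriv τ (pixelMid N n) * (x - pixelMid N n) :=
  sum_mul_boxcar hx fun m => τ (pixelMid N m) + deriv τ (pixelMid N m) * (x - pixelMid N m)

lemma abs_sub_pixelMid_le {n : Fin N} {x : ℝ} (hx : x ∈ pixelInterior N n) :
    |x - pixelMid N n| ≤ 1 / (2 * N) := by
  have hN : (0 : ℝ) < N := Nat.cast_pos.2 n.pos
  obtain ⟨h1, h2⟩ := hx
  have e1 : (n : ℝ) / N = pixelMid N n - 1 / (2 * N) := by rw [pixelMid]; field_simp; ring
  have e2 : ((n : ℝ) + 1) / N = pixelMid N n + 1 / (2 * N) := by rw [pixelMid]; field_simp; ring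
  rw [abs_le]; constructor <;> linarith

lemma pixelInterior_subset (n : Fin N) : pixelInterior N n ⊆ Icc 0 1 := by
  have hN : (0 : ℝ) < N := Nat.cast_pos.2 n.pos
  intro x hx
  refine ⟨le_trans (by positivity) hx.1.le, hx.2.le.trans ?_⟩
  rw [div_le_one hN]
  exact_mod_cast n.2

lemma pixelMid_mem (n : Fin N) : pixelMid N n ∈ pixelInterior N n := by
  have hN : (0 : ℝ) < N := Nat.cast_pos.2 n.pos
  rw [pixelMid]
  constructor
  · rw [div_lt_div_iff₀ hN (by positivity)]; nlinarith
  · rw [div_lt_div_iff₀ (by positivity) hN]; nlinarith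

/-- The unit interval is cut into its pixels. -/
lemma integral_eq_sum_pixels (hN : 1 ≤ N) {G : ℝ → ℝ} {g : Fin N → ℝ → ℝ}
    (hg : ∀ n, Continuous (g n)) (hG : ∀ n, EqOn G (g n) (pixelInterior N n)) :
    ∫ x in (0 : ℝ)..1, G x = ∑ n : Fin N, ∫ x in ((n : ℝ) / N)..(((n : ℝ) + 1) / N), g n x := by
  have hN0 : (0 : ℝ) < N := by exact_mod_cast hN
  have hle : ∀ n : ℕ, (n : ℝ) / N ≤ ((n : ℝ) + 1) / N := fun n => by gcongr; linarith
  have hint : ∀ k < N, IntervalIntegrable G volume (((k : ℕ) : ℝ) / N) (((k + 1 : ℕ) : ℝ) / N) := by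
    intro k hk
    refine ((hg ⟨k, hk⟩).intervalIntegrable _ _).congr_uIoo fun x hx => ?_
    rw [Nat.cast_add_one, uIoo_of_le (hle k)] at hx
    exact (hG ⟨k, hk⟩ hx).symm
  have h := intervalIntegral.sum_integral_adjacent_intervals (f := G) (μ := volume)
    (a := fun k : ℕ => (k : ℝ) / N) (n := N) hint
  simp only [Nat.cast_zero, zero_div, div_self hN0.ne'] at h
  rw [← h, ← Fin.sum_univ_eq_sum_range
    (fun k => ∫ x in ((k : ℝ) / N)..(((k + 1 : ℕ) : ℝ) / N), G x)]
  refine Finset.sum_congr rfl fun n _ => ?_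
  rw [Nat.cast_add_one]
  refine intervalIntegral.integral_congr_Ioo_of_le (hle n) fun x hx => hG n hx

/-- The cross term is odd about the midpoint and vanishes; the square of the linear term over width
`1 / N` gives the factor `1 / 12`. -/
lemma integral_pixel_affine_sq (n : Fin N) (A c : ℝ) :
    ∫ x in ((n : ℝ) / N)..(((n : ℝ) + 1) / N), (A - c * (x - pixelMid N n)) ^ 2 =
      A ^ 2 / N + c ^ 2 / (12 * (N : ℝ) ^ 3) := by
  have hN : (0 : ℝ) < N := Nat.cast_pos.2 n.pos
  set m := pixelMid N n with hm
  have hd : ∀ x : ℝ, HasDerivAt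
      (fun x => A ^ 2 * (x - m) - A * c * (x - m) ^ 2 + c ^ 2 / 3 * (x - m) ^ 3)
      ((A - c * (x - m)) ^ 2) x := by
    intro x
    have h0 : HasDerivAt (fun x : ℝ => x - m) 1 x := (hasDerivAt_id x).sub_const m
    have h := ((h0.const_mul (A ^ 2)).sub ((h0.pow 2).const_mul (A * c))).add
      ((h0.pow 3).const_mul (c ^ 2 / 3))
    refine h.congr_deriv ?_
    push_cast; ring
  rw [intervalIntegral.integral_eq_sub_of_hasDerivAt (fun x _ => hd x)
    ((by fun_prop : Continuous fun x => (A - c * (x - m)) ^ 2).intervalIntegrable _ _)]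
  have e1 : (n : ℝ) / N - m = -(1 / (2 * N)) := by rw [hm, pixelMid]; field_simp; ring
  have e2 : ((n : ℝ) + 1) / N - m = 1 / (2 * N) := by rw [hm, pixelMid]; field_simp; ring
  rw [e1, e2]
  field_simp; ring

/-- The squared distance of a piecewise constant function to the linearized one. -/
lemma integral_reconstruct_sub_linearized_sq (hN : 1 ≤ N) (τ : ℝ → ℝ) (v : Fin N → ℝ) :
    ∫ x in (0 : ℝ)..1, (reconstruct N v x - linearized N τ x) ^ 2 =
      meanSqSlope N τ / (12 * (N : ℝ) ^ 2) +
        (1 / (N : ℝ)) * ∑ n, (v n - τ (pixelMid N n)) ^ 2 := by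
  have hN0 : (0 : ℝ) < N := by exact_mod_cast hN
  rw [integral_eq_sum_pixels hN (g := fun n x => ((v n - τ (pixelMid N n)) -
    deriv τ (pixelMid N n) * (x - pixelMid N n)) ^ 2) (fun n => by fun_prop)]
  · simp_rw [integral_pixel_affine_sq]
    rw [Finset.sum_add_distrib, ← Finset.sum_div, ← Finset.sum_div, meanSqSlope]
    field_simp; ring
  · intro n x hx
    simp only [reconstruct_pixel hx, linearized_pixel hx]
    ring

/-- The squared distance of a piecewise constant function to a continuous one. -/
lemma integral_reconstruct_sub_sq (hN : 1 ≤ N) {τ : ℝ → ℝ} (hτ : Continuous τ) (v : Fin N → ℝ) :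
    ∫ x in (0 : ℝ)..1, (reconstruct N v x - τ x) ^ 2 =
      ∑ n : Fin N, (v n ^ 2 * (1 / N) - 2 * v n *
        (∫ x in ((n : ℝ) / N)..(((n : ℝ) + 1) / N), τ x) +
        ∫ x in ((n : ℝ) / N)..(((n : ℝ) + 1) / N), τ x ^ 2) := by
  rw [integral_eq_sum_pixels hN (g := fun n x => v n ^ 2 - 2 * v n * τ x + τ x ^ 2)
    (fun n => by fun_prop)]
  · refine Finset.sum_congr rfl fun n _ => ?_
    have h1 : Continuous fun x => 2 * v n * τ x := by fun_prop
    have h2 : Continuous fun x => τ x ^ 2 := by fun_prop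
    have h3 : Continuous fun x => v n ^ 2 - 2 * v n * τ x := by fun_prop
    rw [intervalIntegral.integral_add (h3.intervalIntegrable _ _)
      (h2.intervalIntegrable _ _), intervalIntegral.integral_sub
      (continuous_const.intervalIntegrable _ _) (h1.intervalIntegrable _ _),
      intervalIntegral.integral_const_mul, intervalIntegral.integral_const, smul_eq_mul]
    ring
  · intro n x hx
    simp only [reconstruct_pixel hx]
    ring

end pixels

/-! ### Mean squared errors and the effect of linearization. -/

section error

variable {Ω : Type*} [MeasurableSpace Ω] {P : Measure Ω} [IsProbabilityMeasure P] {N : ℕ}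
  {est : Fin N → Ω → ℝ} {a b : ℝ}

lemma integrable_of_ae_mem_Icc (hm : ∀ n, AEMeasurable (est n) P)
    (hab : ∀ n, ∀ᵐ ω ∂P, est n ω ∈ Icc a b) {g : ℝ → ℝ} (hg : Continuous g) (n : Fin N) :
    Integrable (fun ω => g (est n ω)) P := by
  obtain ⟨B, hB⟩ := isCompact_Icc.exists_bound_of_continuousOn (s := Icc a b) hg.continuousOn
  refine Integrable.of_bound (hg.measurable.comp_aemeasurable (hm n)).aestronglyMeasurable B ?_
  filter_upwards [hab n] with ω hω using hB _ hω

/-- The bias-variance decomposition of the error against the linearized function. -/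
lemma mse_linearized (hN : 1 ≤ N) (hm : ∀ n, AEMeasurable (est n) P)
    (hab : ∀ n, ∀ᵐ ω ∂P, est n ω ∈ Icc a b) (τ : ℝ → ℝ) :
    mse P N est (linearized N τ) = meanSqSlope N τ / (12 * (N : ℝ) ^ 2) +
      (1 / (N : ℝ)) * ∑ n : Fin N, pixelError P (est n) (τ (pixelMid N n)) := by
  have hi : ∀ n, Integrable (fun ω => (est n ω - τ (pixelMid N n)) ^ 2) P := fun n =>
    integrable_of_ae_mem_Icc hm hab
      (by fun_prop : Continuous fun x : ℝ => (x - τ (pixelMid N n)) ^ 2) n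
  simp only [mse, integral_reconstruct_sub_linearized_sq hN, pixelError]
  rw [integral_add (integrable_const _) ((integrable_finsetSum _ fun n _ => hi n).const_mul _),
    integral_const, integral_const_mul, integral_finsetSum _ fun n _ => hi n]
  simp

/-- Minkowski's inequality from weighted Young bounds. The optimal weight is `c = δ / √y`; adding `η
/ 2` to both terms keeps the quotient defined when either vanishes. -/
lemma sqrt_le_sqrt_add_of_forall {x y δ : ℝ} (hy : 0 ≤ y) (hδ : 0 ≤ δ)
    (h : ∀ c : ℝ, 0 < c → x ≤ (1 + c) * y + (1 + 1 / c) * δ ^ 2) : √x ≤ √y + δ := by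
  refine le_of_forall_pos_le_add fun η hη => ?_
  set S := √y + η / 2 with hS
  set D := δ + η / 2 with hD
  have hS0 : 0 < S := by positivity
  have hD0 : 0 < D := by positivity
  have hyS : y ≤ S ^ 2 := by
    rw [← Real.sq_sqrt hy]
    exact pow_le_pow_left₀ (Real.sqrt_nonneg _) (by linarith) 2
  have hδD : δ ^ 2 ≤ D ^ 2 := pow_le_pow_left₀ hδ (by linarith) 2
  have hx : x ≤ (S + D) ^ 2 := by
    calc x ≤ (1 + D / S) * y + (1 + 1 / (D / S)) * δ ^ 2 := h _ (by positivity)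
      _ ≤ (1 + D / S) * S ^ 2 + (1 + 1 / (D / S)) * D ^ 2 := by gcongr
      _ = (S + D) ^ 2 := by field_simp; ring
  calc √x ≤ S + D := Real.sqrt_le_iff.2 ⟨by positivity, hx⟩
    _ = √y + δ + η := by rw [hS, hD]; ring

lemma sq_add_le_weighted (u w : ℝ) {c : ℝ} (hc : 0 < c) :
    (u + w) ^ 2 ≤ (1 + c) * u ^ 2 + (1 + 1 / c) * w ^ 2 := by
  have h : (1 + c) * u ^ 2 + (1 + 1 / c) * w ^ 2 - (u + w) ^ 2 = (c * u - w) ^ 2 / c := by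
    field_simp; ring
  have : 0 ≤ (c * u - w) ^ 2 / c := by positivity
  linarith

/-- The root mean squared errors against two uniformly close functions are close. -/
lemma abs_sqrt_mse_sub_le (hN : 1 ≤ N) (hm : ∀ n, AEMeasurable (est n) P)
    (hab : ∀ n, ∀ᵐ ω ∂P, est n ω ∈ Icc a b) {τ : ℝ → ℝ} (hτ : Continuous τ) {δ : ℝ}
    (hδ : 0 ≤ δ) (hclose : ∀ n : Fin N, ∀ x ∈ pixelInterior N n, |τ x - linearized N τ x| ≤ δ) :
    |√(mse P N est τ) - √(mse P N est (linearized N τ))| ≤ δ := by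
  have hN0 : (0 : ℝ) < N := by exact_mod_cast hN
  set A : Ω → ℝ := fun ω => ∫ x in (0 : ℝ)..1, (reconstruct N (fun n => est n ω) x - τ x) ^ 2
  set B : Ω → ℝ := fun ω =>
    ∫ x in (0 : ℝ)..1, (reconstruct N (fun n => est n ω) x - linearized N τ x) ^ 2
  have hA0 : ∀ ω, 0 ≤ A ω := fun ω =>
    intervalIntegral.integral_nonneg zero_le_one fun x _ => sq_nonneg _
  have hB0 : ∀ ω, 0 ≤ B ω := fun ω =>
    intervalIntegral.integral_nonneg zero_le_one fun x _ => sq_nonneg _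
  have hAi : Integrable A P := by
    -- Expanding the square makes `A` a quadratic polynomial in the bounded estimates, so joint
    -- measurability in `ω` and `x` is not needed.
    simp only [A, integral_reconstruct_sub_sq hN hτ]
    refine integrable_finsetSum _ fun n _ => ?_
    exact integrable_of_ae_mem_Icc hm hab (by fun_prop : Continuous fun v : ℝ =>
      v ^ 2 * (1 / N) - 2 * v * (∫ x in ((n : ℝ) / N)..(((n : ℝ) + 1) / N), τ x) +
        ∫ x in ((n : ℝ) / N)..(((n : ℝ) + 1) / N), τ x ^ 2) n
  have hBi : Integrable B P := by
    simp only [B, integral_reconstruct_sub_linearized_sq hN]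
    refine (integrable_const _).add (Integrable.const_mul (integrable_finsetSum _ fun n _ => ?_) _)
    exact integrable_of_ae_mem_Icc hm hab
      (by fun_prop : Continuous fun x : ℝ => (x - τ (pixelMid N n)) ^ 2) n
  -- comparison of integrals of functions that are continuous on the pixels
  have hpix : ∀ (G H : ℝ → ℝ) (g h : Fin N → ℝ → ℝ), (∀ n, Continuous (g n)) →
      (∀ n, Continuous (h n)) → (∀ n, EqOn G (g n) (pixelInterior N n)) →
      (∀ n, EqOn H (h n) (pixelInterior N n)) → ∀ c : ℝ, 0 < c →
      (∀ n, ∀ x ∈ pixelInterior N n, G x ≤ (1 + c) * H x + (1 + 1 / c) * δ ^ 2) →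
      ∫ x in (0 : ℝ)..1, G x ≤ (1 + c) * (∫ x in (0 : ℝ)..1, H x) + (1 + 1 / c) * δ ^ 2 := by
    intro G H g h hg hh hG hH c hc hle
    rw [integral_eq_sum_pixels hN hg hG, integral_eq_sum_pixels hN hh hH, Finset.mul_sum]
    have hδsum : (1 + 1 / c) * δ ^ 2 = ∑ n : Fin N, (1 / (N : ℝ)) * ((1 + 1 / c) * δ ^ 2) := by
      rw [Finset.sum_const, Finset.card_univ, Fintype.card_fin, nsmul_eq_mul, ← mul_assoc,
        mul_one_div_cancel hN0.ne', one_mul]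
    rw [hδsum, ← Finset.sum_add_distrib]
    refine Finset.sum_le_sum fun n _ => ?_
    have hhc : Continuous fun x => (1 + c) * h n x := continuous_const.mul (hh n)
    have hlen : (n : ℝ) / N ≤ ((n : ℝ) + 1) / N := by gcongr; linarith
    calc ∫ x in ((n : ℝ) / N)..(((n : ℝ) + 1) / N), g n x
        ≤ ∫ x in ((n : ℝ) / N)..(((n : ℝ) + 1) / N),
            ((1 + c) * h n x + (1 + 1 / c) * δ ^ 2) := by
          refine intervalIntegral.integral_mono_on_of_le_Ioo hlen
            ((hg n).intervalIntegrable _ _)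
            ((hhc.add continuous_const).intervalIntegrable _ _) ?_
          intro x hx
          rw [← hG n hx, ← hH n hx]
          exact hle n x hx
      _ = _ := by
          rw [intervalIntegral.integral_add
            (hhc.intervalIntegrable _ _)
            (continuous_const.intervalIntegrable _ _), intervalIntegral.integral_const_mul,
            intervalIntegral.integral_const, smul_eq_mul]
          congr 2
          field_simp; ring
  have hcontA : ∀ (v : Fin N → ℝ) (n : Fin N), Continuous fun x => (v n - τ x) ^ 2 :=
    fun v n => by fun_prop
  have hcontB : ∀ (v : Fin N → ℝ) (n : Fin N), Continuous fun x =>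
      (v n - (τ (pixelMid N n) + deriv τ (pixelMid N n) * (x - pixelMid N n))) ^ 2 :=
    fun v n => by fun_prop
  have heqA : ∀ (v : Fin N → ℝ) (n : Fin N), EqOn (fun x => (reconstruct N v x - τ x) ^ 2)
      (fun x => (v n - τ x) ^ 2) (pixelInterior N n) := fun v n x hx => by
    simp only [reconstruct_pixel hx]
  have heqB : ∀ (v : Fin N → ℝ) (n : Fin N),
      EqOn (fun x => (reconstruct N v x - linearized N τ x) ^ 2)
      (fun x => (v n - (τ (pixelMid N n) + deriv τ (pixelMid N n) * (x - pixelMid N n))) ^ 2)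
      (pixelInterior N n) := fun v n x hx => by
    simp only [reconstruct_pixel hx, linearized_pixel hx]
  have hsq : ∀ n : Fin N, ∀ x ∈ pixelInterior N n, (τ x - linearized N τ x) ^ 2 ≤ δ ^ 2 :=
    fun n x hx => by
      rw [← sq_abs]; exact pow_le_pow_left₀ (abs_nonneg _) (hclose n x hx) 2
  have hAB : ∀ c : ℝ, 0 < c → ∀ ω, A ω ≤ (1 + c) * B ω + (1 + 1 / c) * δ ^ 2 := fun c hc ω => by
    refine hpix _ _ _ _ (hcontA _) (hcontB _) (heqA _) (heqB _) c hc fun n x hx => ?_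
    have h1 := sq_add_le_weighted (reconstruct N (fun n => est n ω) x - linearized N τ x)
      (linearized N τ x - τ x) hc
    rw [sub_add_sub_cancel] at h1
    have h2 := mul_le_mul_of_nonneg_left (hsq n x hx) (by positivity : 0 ≤ 1 + 1 / c)
    rw [sub_sq_comm] at h2
    linarith
  have hBA : ∀ c : ℝ, 0 < c → ∀ ω, B ω ≤ (1 + c) * A ω + (1 + 1 / c) * δ ^ 2 := fun c hc ω => by
    refine hpix _ _ _ _ (hcontB _) (hcontA _) (heqB _) (heqA _) c hc fun n x hx => ?_
    have h1 := sq_add_le_weighted (reconstruct N (fun n => est n ω) x - τ x)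
      (τ x - linearized N τ x) hc
    rw [sub_add_sub_cancel] at h1
    have h2 := mul_le_mul_of_nonneg_left (hsq n x hx) (by positivity : 0 ≤ 1 + 1 / c)
    linarith
  have hmono : ∀ {F G : Ω → ℝ}, Integrable F P → Integrable G P → ∀ c : ℝ,
      (∀ ω, F ω ≤ (1 + c) * G ω + (1 + 1 / c) * δ ^ 2) →
      ∫ ω, F ω ∂P ≤ (1 + c) * (∫ ω, G ω ∂P) + (1 + 1 / c) * δ ^ 2 := by
    intro F G hF hG c h
    refine (integral_mono hF ((hG.const_mul _).add (integrable_const _)) h).trans_eq ?_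
    rw [integral_add' (hG.const_mul _) (integrable_const _), integral_const_mul, integral_const]
    simp
  have h1 : √(mse P N est τ) ≤ √(mse P N est (linearized N τ)) + δ :=
    sqrt_le_sqrt_add_of_forall (integral_nonneg hB0) hδ fun c hc => hmono hAi hBi c (hAB c hc)
  have h2 : √(mse P N est (linearized N τ)) ≤ √(mse P N est τ) + δ :=
    sqrt_le_sqrt_add_of_forall (integral_nonneg hA0) hδ fun c hc => hmono hBi hAi c (hBA c hc)
  rw [abs_le]; constructor <;> linarith

end error

/-- The error of the tangent of a function whose derivative is Lipschitz. -/
lemma abs_sub_tangent_le {τ : ℝ → ℝ} {K : ℝ} {S : Set ℝ} (hS : Convex ℝ S)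
    (hd : ∀ x ∈ S, DifferentiableAt ℝ τ x)
    (hK : ∀ x ∈ S, ∀ y ∈ S, |deriv τ x - deriv τ y| ≤ K * |x - y|) {x y : ℝ} (hx : x ∈ S)
    (hy : y ∈ S) : |τ y - (τ x + deriv τ x * (y - x))| ≤ K / 2 * (y - x) ^ 2 := by
  set d := y - x with hdd
  have hmem : ∀ t ∈ Icc (0 : ℝ) 1, x + t * d ∈ S := fun t ht => by
    have := hS.add_smul_sub_mem hx hy ht
    rwa [smul_eq_mul] at this
  have hk : ∀ t ∈ Icc (0 : ℝ) 1, HasDerivAt (fun t => τ (x + t * d) - τ x - deriv τ x * (t * d))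
      ((deriv τ (x + t * d) - deriv τ x) * d) t := by
    intro t ht
    have h1 : HasDerivAt (fun t : ℝ => t * d) d t := by
      simpa using (hasDerivAt_id t).mul_const d
    have h2 := (hd _ (hmem t ht)).hasDerivAt.comp t (h1.const_add x)
    refine ((h2.sub_const (τ x)).sub (h1.const_mul (deriv τ x))).congr_deriv ?_
    ring
  -- The remainder along the segment has derivative at most `K * d ^ 2 * t`. Comparing with the
  -- antiderivative of this bound, rather than with its maximum, produces the factor `1 / 2`.
  have hbd := image_norm_le_of_norm_deriv_right_le_deriv_boundary
    (f := fun t => τ (x + t * d) - τ x - deriv τ x * (t * d)) (a := 0) (b := 1)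
    (f' := fun t => (deriv τ (x + t * d) - deriv τ x) * d)
    (B := fun t => K / 2 * d ^ 2 * t ^ 2) (B' := fun t => K * d ^ 2 * t)
    (fun t ht => (hk t ht).continuousAt.continuousWithinAt)
    (fun t ht => (hk t (Ico_subset_Icc_self ht)).hasDerivWithinAt) (by simp)
    (fun t => ((hasDerivAt_pow 2 t).const_mul (K / 2 * d ^ 2)).congr_deriv (by push_cast; ring))
    (fun t ht => by
      have h1 := hK _ (hmem t (Ico_subset_Icc_self ht)) x hx
      rw [add_sub_cancel_left, abs_mul, abs_of_nonneg ht.1] at h1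
      rw [norm_mul, Real.norm_eq_abs, Real.norm_eq_abs]
      calc _ ≤ K * (t * |d|) * |d| := mul_le_mul_of_nonneg_right h1 (abs_nonneg d)
        _ = K * |d| ^ 2 * t := by ring
        _ = K * d ^ 2 * t := by rw [sq_abs])
    (right_mem_Icc.2 zero_le_one)
  simp only [one_mul, one_pow, mul_one, Real.norm_eq_abs] at hbd
  rw [hdd, add_sub_cancel] at hbd
  rw [hdd, ← sub_sub]
  exact hbd

/-! ### Regularity of the effective pulse from its normalization. -/

section effectivePulse

variable {s φ τ : ℝ → ℝ} {T a b : ℝ} {N : ℕ}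

/-- The normalization on the window confines the transmitted pulse. -/
lemma ae_shift_eq_zero_of_normalized (hT : 0 < T) (hs : Continuous s) (hs0 : ∀ t, 0 ≤ s t)
    (hs1 : ∫ t, s t = 1) (hφ0 : ∀ y, 0 ≤ φ y) (hφ1 : ∫ y, φ y = 1) (hτ : Continuous τ) {n : Fin N}
    {θ : ℝ} (hθ : ∫ t in (-T)..T, effPulse φ s τ N n (t - θ) = 1) :
    ∀ᵐ y, φ y ≠ 0 → ∀ u ∉ Icc (-T - θ) (T - θ),
      s (u + (τ (pixelMid N n) - τ (pixelMid N n - y))) = 0 := by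
  have hφ : Integrable φ := by
    by_contra hcon
    rw [integral_undef hcon] at hφ1
    norm_num at hφ1
  refine ae_eq_zero_of_setIntegral_delayMixture hφ hφ0 hφ1 (by fun_prop) hs hs0 hs1 ?_
  rw [← effPulse_eq_delayMixture, integral_Icc_eq_integral_Ioc,
    ← intervalIntegral.integral_of_le (by linarith),
    ← intervalIntegral.integral_comp_sub_right (effPulse φ s τ N n) θ]
  exact hθ

lemma hasCompactSupport_of_normalized (hT : 0 < T) (hs : Continuous s) (hs0 : ∀ t, 0 ≤ s t)
    (hs1 : ∫ t, s t = 1) (hφ0 : ∀ y, 0 ≤ φ y) (hφ1 : ∫ y, φ y = 1) (hτ : Continuous τ) {n : Fin N}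
    {θ : ℝ} (hθ : ∫ t in (-T)..T, effPulse φ s τ N n (t - θ) = 1) : HasCompactSupport s :=
  hasCompactSupport_of_ae_shift hφ1
    (ae_shift_eq_zero_of_normalized hT hs hs0 hs1 hφ0 hφ1 hτ hθ)

/-- The compact support of `s`, forced by the normalization at delay zero, bounds `s` and its first
two derivatives, which permits differentiating the mixture twice under the integral. The support at
each delay follows from the normalization at that delay. -/
lemma windowedPulse_effPulse (hT : 0 < T) (hs : ContDiff ℝ 2 s) (hs0 : ∀ t, 0 ≤ s t)
    (hs1 : ∫ t, s t = 1) (hφ0 : ∀ y, 0 ≤ φ y) (hφ1 : ∫ y, φ y = 1) (hτ : Continuous τ) (n : Fin N)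
    (hnorm : ∀ θ ∈ insert 0 (Icc a b), ∫ t in (-T)..T, effPulse φ s τ N n (t - θ) = 1) :
    ∃ g' g'' : ℝ → ℝ, WindowedPulse (effPulse φ s τ N n) g' g'' T a b := by
  have hφ : Integrable φ := by
    by_contra hcon
    rw [integral_undef hcon] at hφ1
    norm_num at hφ1
  set k := fun y => τ (pixelMid N n) - τ (pixelMid N n - y) with hk
  have hkc : Continuous k := by fun_prop
  have hsupp := hasCompactSupport_of_normalized hT hs.continuous hs0 hs1 hφ0 hφ1 hτ
    (hnorm 0 (mem_insert _ _))
  have hs' : ContDiff ℝ 1 (deriv s) := by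
    have : ContDiff ℝ (1 + 1) s := by simpa [one_add_one_eq_two] using hs
    exact (contDiff_succ_iff_deriv.1 this).2.2
  have hc'' : Continuous (deriv (deriv s)) := hs'.continuous_deriv le_rfl
  obtain ⟨B, hB⟩ := hsupp.exists_bound_of_continuous hs.continuous
  obtain ⟨B', hB'⟩ := hsupp.deriv.exists_bound_of_continuous hs'.continuous
  obtain ⟨B'', hB''⟩ := hsupp.deriv.deriv.exists_bound_of_continuous hc''
  refine ⟨delayMixture φ k (deriv s), delayMixture φ k (deriv (deriv s)), ?_, ?_, ?_, ?_, hnorm, ?_⟩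
  · intro u
    rw [effPulse_eq_delayMixture]
    exact integral_nonneg fun y => mul_nonneg (hφ0 _) (hs0 _)
  · rw [effPulse_eq_delayMixture]
    exact hasDerivAt_delayMixture hφ hkc
      (fun u => ((hs.differentiable (by norm_num)) u).hasDerivAt) hs'.continuous hB hB'
  · exact hasDerivAt_delayMixture hφ hkc
      (fun u => ((hs'.differentiable (by norm_num)) u).hasDerivAt) hc'' hB' hB''
  · exact continuous_delayMixture hφ hkc hc'' hB''
  · intro θ hθ u hu
    rw [effPulse_eq_delayMixture]
    exact delayMixture_eq_zero
      (ae_shift_eq_zero_of_normalized hT hs.continuous hs0 hs1 hφ0 hφ1 hτ (hnorm θ hθ)) hu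

end effectivePulse

/-! ### Assembly of the statements. -/

theorem theorem5
    {Ω : Type*} [MeasurableSpace Ω] (P : Measure Ω) [IsProbabilityMeasure P]
    -- number of pixels, half-length of the window, background-to-signal ratio, range of delays
    (N : ℕ) (hN : 1 ≤ N) (T : ℝ) (hT : 0 < T) (β : ℝ) (hβ : 0 < β) (a b : ℝ)
    -- the transmitted pulse
    (s : ℝ → ℝ) (hs_smooth : ContDiff ℝ 2 s) (hs_nonneg : ∀ t, 0 ≤ s t) (hs_int : ∫ t, s t = 1)
    -- the spatial kernel
    (φ : ℝ → ℝ) (hφ_nonneg : ∀ y, 0 ≤ φ y) (hφ_int : ∫ y, φ y = 1)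
    -- the true time-of-arrival function
    (τ : ℝ → ℝ) (hτ_cont : Continuous τ)
    (hτ_diff : ∀ n : Fin N, DifferentiableAt ℝ τ (pixelMid N n))
    (hτ_range : ∀ n : Fin N, τ (pixelMid N n) ∈ Ioo a b)
    -- each effective pulse is normalized on the window, at delay zero and at all admitted delays
    (h_norm : ∀ n : Fin N, ∀ θ ∈ insert 0 (Icc a b),
      ∫ t in (-T)..T, effPulse φ s τ N n (t - θ) = 1)
    -- the time stamps of each pixel, for each total flux `α₀` of the scene:
    -- pixel signal level `α₀ / N`, pixel noise floor `β * (α₀ / N)`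
    (X : ℝ → Fin N → Ω → TimeStamps)
    (hX : ∀ α₀ : ℝ, 0 < α₀ → ∀ n : Fin N,
      HasLaw (X α₀ n) (timeStampLaw T (effIntensity φ (α₀ / N) (β * (α₀ / N)) s τ N n)) P)
    -- the maximum-likelihood estimates
    (τhat : ℝ → Fin N → Ω → ℝ)
    (hτhat_meas : ∀ α₀ : ℝ, 0 < α₀ → ∀ n : Fin N, AEMeasurable (τhat α₀ n) P)
    (hτhat : ∀ α₀ : ℝ, 0 < α₀ → ∀ n : Fin N, ∀ᵐ ω ∂P,
      IsMLE (α₀ / N) (β * (α₀ / N)) (effPulse φ s τ N n) (Icc a b) (X α₀ n ω) (τhat α₀ n ω)) :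
    -- the effective return pulse is `α s_n(t - τ_n) + λ_b`
    (∀ (α lamb : ℝ) (n : Fin N) (t : ℝ), effIntensity φ α lamb s τ N n t =
      α * effPulse φ s τ N n (t - τ (pixelMid N n)) + lamb) ∧
    -- the Fisher integrals are positive
    (∀ α : ℝ, 0 < α → ∀ n : Fin N, 0 < fisherIntegral T α (β * α) (effPulse φ s τ N n)) ∧
    -- per-pixel variance, to leading order in the flux
    (∀ n : Fin N,
      (fun α₀ : ℝ => pixelError P (τhat α₀ n) (τ (pixelMid N n))) ~[atTop]
        fun α₀ : ℝ => (fisherIntegral T (α₀ / N) (β * (α₀ / N)) (effPulse φ s τ N n))⁻¹) ∧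
    -- bias and variance, for the linearized time-of-arrival function, exactly
    (∀ α₀ : ℝ, 0 < α₀ →
      mse P N (τhat α₀) (linearized N τ) =
        meanSqSlope N τ / (12 * (N : ℝ) ^ 2) +
          (1 / (N : ℝ)) * ∑ n : Fin N, pixelError P (τhat α₀ n) (τ (pixelMid N n))) ∧
    -- the overall formula, with the flux factor `N / α₀` and the variances at unit signal level
    ((fun α₀ : ℝ => mse P N (τhat α₀) (linearized N τ) -
        meanSqSlope N τ / (12 * (N : ℝ) ^ 2)) ~[atTop]
      fun α₀ : ℝ => ((N : ℝ) / α₀) *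
        ((1 / (N : ℝ)) * ∑ n : Fin N, (fisherIntegral T 1 β (effPulse φ s τ N n))⁻¹)) ∧
    -- the error made by the linearization of the time-of-arrival function
    (∀ K : ℝ, (∀ x ∈ Icc (0 : ℝ) 1, DifferentiableAt ℝ τ x) →
      (∀ x ∈ Icc (0 : ℝ) 1, ∀ y ∈ Icc (0 : ℝ) 1, |deriv τ x - deriv τ y| ≤ K * |x - y|) →
      ∀ α₀ : ℝ, 0 < α₀ →
        |√(mse P N (τhat α₀) τ) - √(mse P N (τhat α₀) (linearized N τ))|
          ≤ K / (8 * (N : ℝ) ^ 2)) := by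
  have hN0 : (0 : ℝ) < N := by exact_mod_cast hN
  have hφ : Integrable φ := by
    by_contra hcon
    rw [integral_undef hcon] at hφ_int
    norm_num at hφ_int
  have hpulse := fun n => windowedPulse_effPulse hT hs_smooth hs_nonneg hs_int hφ_nonneg hφ_int
    hτ_cont n (h_norm n)
  obtain ⟨B, hB⟩ := (hasCompactSupport_of_normalized hT hs_smooth.continuous hs_nonneg hs_int
    hφ_nonneg hφ_int hτ_cont (h_norm ⟨0, hN⟩ 0 (mem_insert _ _))).exists_bound_of_continuous
    hs_smooth.continuous
  have hint := effIntensity_eq_of_bounded (N := N) hφ hφ_int hτ_cont hs_smooth.continuous hB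
  have hfisher : ∀ n : Fin N, 0 < fisherIntegral T 1 β (effPulse φ s τ N n) := fun n => by
    obtain ⟨g', g'', hg⟩ := hpulse n
    exact hg.fisherIntegral_one_pos hT hβ
  have hmem : ∀ α₀ : ℝ, 0 < α₀ → ∀ n : Fin N, ∀ᵐ ω ∂P, τhat α₀ n ω ∈ Icc a b :=
    fun α₀ hα₀ n => (hτhat α₀ hα₀ n).mono fun ω hω => hω.1
  have hrate : Tendsto (fun α₀ : ℝ => α₀ / N) atTop atTop := tendsto_id.atTop_div_const hN0
  have hlim : ∀ n : Fin N, Tendsto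
      (fun α₀ : ℝ => α₀ / N * pixelError P (τhat α₀ n) (τ (pixelMid N n))) atTop
      (𝓝 (fisherIntegral T 1 β (effPulse φ s τ N n))⁻¹) := fun n => by
    obtain ⟨g', g'', hg⟩ := hpulse n
    refine hg.tendsto_mul_pixelError (X := fun α₀ => X α₀ n) hrate hT hβ (hτ_range n) ?_ ?_ ?_
    · filter_upwards [eventually_gt_atTop 0] with α₀ hα₀
      rw [← hg.timeStampLaw_eq (div_pos hα₀ hN0) (τ (pixelMid N n)) fun t =>
        hint (α₀ / N) (β * (α₀ / N)) n t]
      exact hX α₀ hα₀ n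
    · filter_upwards [eventually_gt_atTop 0] with α₀ hα₀ using hτhat_meas α₀ hα₀ n
    · filter_upwards [eventually_gt_atTop 0] with α₀ hα₀ using hτhat α₀ hα₀ n
  have hmse : ∀ α₀ : ℝ, 0 < α₀ → mse P N (τhat α₀) (linearized N τ) =
      meanSqSlope N τ / (12 * (N : ℝ) ^ 2) +
        (1 / (N : ℝ)) * ∑ n : Fin N, pixelError P (τhat α₀ n) (τ (pixelMid N n)) :=
    fun α₀ hα₀ => mse_linearized hN (hτhat_meas α₀ hα₀) (hmem α₀ hα₀) τ
  refine ⟨hint, fun α hα n => ?_, fun n => ?_, hmse, ?_, fun K hdiff hK α₀ hα₀ => ?_⟩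
  · rw [fisherIntegral_scale _ _ _ hα]
    exact mul_pos hα (hfisher n)
  · have hJ := hfisher n
    refine (isEquivalent_iff_tendsto_one ?_).2 ?_
    · filter_upwards [eventually_gt_atTop 0] with α₀ hα₀
      rw [fisherIntegral_scale _ _ _ (div_pos hα₀ hN0)]
      have := div_pos hα₀ hN0
      positivity
    · have h1 := (hlim n).mul_const (fisherIntegral T 1 β (effPulse φ s τ N n))
      rw [inv_mul_cancel₀ hJ.ne'] at h1
      refine h1.congr' ?_
      filter_upwards [eventually_gt_atTop 0] with α₀ hα₀
      rw [Pi.div_apply, fisherIntegral_scale _ _ _ (div_pos hα₀ hN0), div_inv_eq_mul]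
      ring
  · have hV : 0 < (1 / (N : ℝ)) * ∑ n : Fin N, (fisherIntegral T 1 β (effPulse φ s τ N n))⁻¹ :=
      mul_pos (by positivity) (Finset.sum_pos (fun n _ => inv_pos.2 (hfisher n))
        ⟨⟨0, hN⟩, Finset.mem_univ _⟩)
    set V := (1 / (N : ℝ)) * ∑ n : Fin N, (fisherIntegral T 1 β (effPulse φ s τ N n))⁻¹ with hVdef
    refine (isEquivalent_iff_tendsto_one ?_).2 ?_
    · filter_upwards [eventually_gt_atTop 0] with α₀ hα₀
      positivity
    · have h1 := ((tendsto_finsetSum Finset.univ fun n _ => hlim n).const_mul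
        (1 / (N : ℝ))).mul_const V⁻¹
      rw [← hVdef, mul_inv_cancel₀ hV.ne'] at h1
      refine h1.congr' ?_
      filter_upwards [eventually_gt_atTop 0] with α₀ hα₀
      rw [Pi.div_apply, hmse α₀ hα₀, add_sub_cancel_left, ← Finset.mul_sum]
      field_simp
  -- The Lipschitz bound between the endpoints `0` and `1` already forces the sign of `K`.
  · have hK0 : 0 ≤ K := by
      have := hK 0 (by simp) 1 (by simp)
      simp only [zero_sub, abs_neg, abs_one, mul_one] at this
      exact (abs_nonneg _).trans this
    refine abs_sqrt_mse_sub_le hN (hτhat_meas α₀ hα₀) (hmem α₀ hα₀) hτ_cont (by positivity)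
      fun n x hx => ?_
    rw [linearized_pixel hx]
    refine (abs_sub_tangent_le (convex_Icc 0 1) hdiff hK
      (pixelInterior_subset n (pixelMid_mem n)) (pixelInterior_subset n hx)).trans ?_
    rw [← sq_abs]
    calc K / 2 * |x - pixelMid N n| ^ 2 ≤ K / 2 * (1 / (2 * N)) ^ 2 := by
          gcongr
          exact abs_sub_pixelMid_le hx
      _ = K / (8 * (N : ℝ) ^ 2) := by field_simp; ring
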